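/- Let $\omega$ be the exponent of a matrix multiplication method, i.e. a real number such that some fixed program multiplies any two complex $d\times d$ matrices in time $O(d^\omega)$. Time is counted on a random access machine with exact complex numbers, where each arithmetic operation on complex numbers (including conjugation, exponential, and the square root of a nonnegative real), each operation on integer registers (addition, truncated subtraction, comparison) and each memory access costs one unit. For $n\ge 2$, let $R$ be the representation of $S_n$ permuting the tensor factors of $(\mathbb C^2)^{\otimes n}$, and call an operator $S_n$-equivariant if it commutes with every $R(\sigma)$. Let $\{|\lambda,p,q\rangle\}$ be a Schur basis: an orthonormal basis, with $\lambda=(n-m,m)$, $0\le m\le\lfloor n/2\rfloor$, $1\le p\le m_\lambda=\frac{n!\,(n-2m+1)!}{(n-m+1)!\,m!\,(n-2m)!}$, $0\le q\le n-2m$, such that $R\cong\bigoplus_\lambda r_\lambda\otimes \mathbb 1$ with pairwise inequivalent irreducible representations $r_\lambda$ acting on the label $p$, and such that for each $\lambda$ there is one label $p=p^0_\lambda$ with $|\lambda,p^0_\lambda,q\rangle=|\Psi\rangle^{\otimes m}\otimes|\Sigma^{(n-2m)}_q\rangle$ for all $q$. Here $|\Psi\rangle=(|01\rangle-|10\rangle)/\sqrt2$,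 and $|\Sigma^{(n-2m)}_q\rangle$ is the Dicke state of Hamming weight $q$ on $n-2m$ qubits. For an $S_n$-equivariant $A$ let $A_\lambda$ be the matrix with entries $\langle\lambda,p^0_\lambda,q|A|\lambda,p^0_\lambda,q'\rangle$. Let $U=\prod_{\ell=1}^L e^{-iH_\ell}$ with $S_n$-equivariant Hermitian generators $H_\ell$, let $\rho$ be any density operator on $n$ qubits, and let $O$ be one of the observables $\frac1n\sum_j P_j$, $\frac2{n(n-1)}\sum_{k<j}P_jP_k$, $\bigotimes_jP_j$ with $P\in\{X,Y,Z\}$. Suppose that the following are given in memory: $n$, $L$, the label of $O$, the matrices $\big(\sum_{p}\langle\lambda,p,q|\rho|\lambda,p,q'\rangle\big)_{q,q'}$ for all $\lambda$, and, for all $\ell$ and $\lambda$, a unitary $Q_{\ell,\lambda}$ and a real diagonal $\Lambda_{\ell,\lambda}$ with $(H_\ell)_\lambda=Q_{\ell,\lambda}\Lambda_{\ell,\lambda}Q_{\ell,\lambda}^\dagger$. Then there is one program, not depending on these data, that computes $f(\rho)=\mathrm{Tr}[U\rho U^\dagger O]$, for constant depth $L\in O(1)$, in time $O(n^{\omega+1})$: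 for every $L_0$ there is a constant $C$ such that the running time is at most $C\,n^{\omega+1}$ for all $n\ge2$, all $L\le L_0$, and all such $H_\ell,\rho,O$ and given data. -/

import Mathlib

namespace SnSim

/-! ## Model of computation

A random access machine with natural number registers and multi-dimensional arrays of complex
numbers.  Programs are the commands of a small imperative language.  Every arithmetic operation,
memory access, constant, comparison and assignment costs one unit of time.  Complex numbers are
exact, and there is no operation that extracts digits or tests of complex numbers. -/

/-- The memory: natural number registers, and arrays with complex entries at lists of indices. -/
structure State where
  nat : ℕ → ℕ
  arr : ℕ → List ℕ → ℂ

/-- Expressions with values in the natural numbers (`sub` is truncated subtraction). -/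
inductive NExp : Type
  | const : ℕ → NExp
  | reg : ℕ → NExp
  | add : NExp → NExp → NExp
  | sub : NExp → NExp → NExp

def NExp.eval (s : State) : NExp → ℕ
  | .const k => k
  | .reg x => s.nat x
  | .add a b => a.eval s + b.eval s
  | .sub a b => a.eval s - b.eval s

/-- The time needed to evaluate an expression: its number of nodes. -/
def NExp.cost : NExp → ℕ
  | .const _ => 1
  | .reg _ => 1
  | .add a b => a.cost + b.cost + 1
  | .sub a b => a.cost + b.cost + 1

/-- Expressions with complex values; `read a idx` is the entry of the array `a` at the position
given by the values of `idx`. -/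
inductive CExp : Type
  | ofNat : NExp → CExp
  | imag : CExp
  | read : ℕ → List NExp → CExp
  | add : CExp → CExp → CExp
  | sub : CExp → CExp → CExp
  | mul : CExp → CExp → CExp
  | div : CExp → CExp → CExp
  | conj : CExp → CExp
  | exp : CExp → CExp
  | sqrt : CExp → CExp

/-- `sqrt` is the square root of a nonnegative real number. -/
noncomputable def CExp.eval (s : State) : CExp → ℂ
  | .ofNat e => (e.eval s : ℂ)
  | .imag => Complex.I
  | .read a idx => s.arr a (idx.map (NExp.eval s))
  | .add a b => a.eval s + b.eval s
  | .sub a b => a.eval s - b.eval s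
  | .mul a b => a.eval s * b.eval s
  | .div a b => a.eval s / b.eval s
  | .conj a => (starRingEnd ℂ) (a.eval s)
  | .exp a => Complex.exp (a.eval s)
  | .sqrt a => (Real.sqrt (a.eval s).re : ℂ)

/-- The time needed to evaluate an expression: its number of nodes, those of indices included. -/
def CExp.cost : CExp → ℕ
  | .ofNat e => e.cost + 1
  | .imag => 1
  | .read _ idx => (idx.map NExp.cost).sum + 1
  | .add a b => a.cost + b.cost + 1
  | .sub a b => a.cost + b.cost + 1
  | .mul a b => a.cost + b.cost + 1
  | .div a b => a.cost + b.cost + 1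
  | .conj a => a.cost + 1
  | .exp a => a.cost + 1
  | .sqrt a => a.cost + 1

/-- Programs.  The conditions of `ite a b _ _` and `loop a b _` are `a < b`. -/
inductive Cmd : Type
  | skip : Cmd
  | setNat : ℕ → NExp → Cmd
  | write : ℕ → List NExp → CExp → Cmd
  | seq : Cmd → Cmd → Cmd
  | ite : NExp → NExp → Cmd → Cmd → Cmd
  | loop : NExp → NExp → Cmd → Cmd

/-- `Run c s t s'`: the program `c`, started in the memory state `s`, halts after exactly `t` units
of time in the memory state `s'`. -/
inductive Run : Cmd → State → ℕ → State → Prop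
  | skip (s : State) : Run .skip s 1 s
  | setNat (x : ℕ) (e : NExp) (s : State) :
      Run (.setNat x e) s (e.cost + 1) { s with nat := Function.update s.nat x (e.eval s) }
  | write (a : ℕ) (idx : List NExp) (e : CExp) (s : State) :
      Run (.write a idx e) s ((idx.map NExp.cost).sum + e.cost + 1)
        { s with arr := Function.update s.arr a
                    (Function.update (s.arr a) (idx.map (NExp.eval s)) (e.eval s)) }
  | seq {c d : Cmd} {s s' s'' : State} {t u : ℕ} (hc : Run c s t s') (hd : Run d s' u s'') :
      Run (.seq c d) s (t + u) s''
  | iteTrue {a b : NExp} {c d : Cmd} {s s' : State} {t : ℕ} (h : a.eval s < b.eval s)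
      (hc : Run c s t s') : Run (.ite a b c d) s (a.cost + b.cost + 1 + t) s'
  | iteFalse {a b : NExp} {c d : Cmd} {s s' : State} {t : ℕ} (h : ¬ a.eval s < b.eval s)
      (hd : Run d s t s') : Run (.ite a b c d) s (a.cost + b.cost + 1 + t) s'
  | loopTrue {a b : NExp} {c : Cmd} {s s' s'' : State} {t u : ℕ} (h : a.eval s < b.eval s)
      (hc : Run c s t s') (hl : Run (.loop a b c) s' u s'') :
      Run (.loop a b c) s (a.cost + b.cost + 1 + t + u) s''
  | loopFalse {a b : NExp} {c : Cmd} {s : State} (h : ¬ a.eval s < b.eval s) :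
      Run (.loop a b c) s (a.cost + b.cost + 1) s

/-- `ω` is the exponent of some matrix multiplication method: one program multiplies any two
complex `d × d` matrices in time `O(d ^ ω)`.  The program finds `d` in register 0 and the factors
in the arrays 0 and 1, and leaves the product in array 2; the rest of the initial memory is
arbitrary. -/
def IsMatMulExponent (ω : ℝ) : Prop :=
  ∃ (P : Cmd) (C : ℝ), ∀ d : ℕ, 1 ≤ d → ∀ (A B : Matrix (Fin d) (Fin d) ℂ) (s : State),
    s.nat 0 = d →
    (∀ i j : Fin d, s.arr 0 [(i : ℕ), (j : ℕ)] = A i j) →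
    (∀ i j : Fin d, s.arr 1 [(i : ℕ), (j : ℕ)] = B i j) →
    ∃ (t : ℕ) (s' : State), Run P s t s' ∧
      (∀ i j : Fin d, s'.arr 2 [(i : ℕ), (j : ℕ)] = (A * B) i j) ∧
      (t : ℝ) ≤ C * (d : ℝ) ^ ω

/-! ## Operators on `n` qubits -/

/-- Labels of the computational basis. -/
abbrev Bits (n : ℕ) : Type := Fin n → Fin 2

/-- The Hilbert space of `n` qubits. -/
abbrev Qubits (n : ℕ) : Type := EuclideanSpace ℂ (Bits n)

/-- Operators on `n` qubits, as matrices in the computational basis. -/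
abbrev Op (n : ℕ) : Type := Matrix (Bits n) (Bits n) ℂ

/-- The qubit-permuting representation: `R(σ) |x₁ … xₙ⟩` has `x_{σ⁻¹(i)}` at place `i`. -/
def permOp {n : ℕ} (σ : Equiv.Perm (Fin n)) : Op n :=
  Matrix.of fun y x => if y = fun i => x (σ⁻¹ i) then 1 else 0

/-- `Sₙ`-equivariant operators. -/
def IsEquivariant {n : ℕ} (A : Op n) : Prop :=
  ∀ σ : Equiv.Perm (Fin n), permOp σ * A = A * permOp σ

open scoped ComplexOrder in
/-- Density operators. -/
def IsDensity {n : ℕ} (ρ : Op n) : Prop := ρ.PosSemidef ∧ ρ.trace = 1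

/-- The tensor product of one-qubit operators. -/
def tensorOp {n : ℕ} (M : Fin n → Matrix (Fin 2) (Fin 2) ℂ) : Op n :=
  Matrix.of fun y x => ∏ j, M j (y j) (x j)

inductive Pauli : Type
  | X | Y | Z

def Pauli.matrix : Pauli → Matrix (Fin 2) (Fin 2) ℂ
  | .X => !![0, 1; 1, 0]
  | .Y => !![0, -Complex.I; Complex.I, 0]
  | .Z => !![1, 0; 0, -1]

/-- The Pauli operator `P` on qubit `j`. -/
def Pauli.onQubit {n : ℕ} (P : Pauli) (j : Fin n) : Op n :=
  tensorOp (Function.update (fun _ => 1) j P.matrix)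

/-- Labels of the observables. -/
inductive Obs : Type
  | oneLocal : Pauli → Obs
  | twoLocal : Pauli → Obs
  | global : Pauli → Obs

/-- The observables `(1/n) ∑_j P_j`, `(2/(n(n-1))) ∑_{k<j} P_j P_k` and `⨂_j P_j`. -/
noncomputable def Obs.op (n : ℕ) : Obs → Op n
  | .oneLocal P => (1 / (n : ℂ)) • ∑ j : Fin n, P.onQubit j
  | .twoLocal P =>
      (2 / ((n : ℂ) * ((n : ℂ) - 1))) • ∑ j : Fin n, ∑ k ∈ Finset.Iio j, P.onQubit j * P.onQubit k
  | .global P => tensorOp fun _ => P.matrix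

/-- The circuit `e^{-iH₁} e^{-iH₂} ⋯ e^{-iH_L}`. -/
noncomputable def circuit {n L : ℕ} (H : Fin L → Op n) : Op n :=
  (List.ofFn fun l => NormedSpace.exp ((-Complex.I) • H l)).prod

/-- The expectation value `Tr[U ρ U† O]`. -/
noncomputable def expectation {n : ℕ} (U ρ O : Op n) : ℂ :=
  (U * ρ * U.conjTranspose * O).trace

/-! ## The Schur basis

The index `m = 0, …, ⌊n/2⌋` stands for the two-row partition `λ = (n - m, m)`. -/

/-- The size `d_λ` of the blocks of equivariant operators. -/
def blockDim (n m : ℕ) : ℕ := n - 2 * m + 1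

/-- The dimension `m_λ` of the irreducible representation of `Sₙ` (the division is exact). -/
def multDim (n m : ℕ) : ℕ :=
  (n.factorial * (n - 2 * m + 1).factorial) /
    ((n - m + 1).factorial * m.factorial * (n - 2 * m).factorial)

/-- Amplitudes of the two-qubit singlet `(|01⟩ - |10⟩)/√2`. -/
noncomputable def singlet (a b : Fin 2) : ℂ :=
  if a = 0 ∧ b = 1 then 1 / (Real.sqrt 2 : ℂ)
  else if a = 1 ∧ b = 0 then -(1 / (Real.sqrt 2 : ℂ)) else 0

/-- The canonical Schur basis vector: `m` singlets on the first `2m` qubits (paired as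
`(1,2), (3,4), …`), times the Dicke state of Hamming weight `q` on the other `n - 2m` qubits. -/
noncomputable def canonicalVec (n : ℕ) (m : Fin (n / 2 + 1)) (q : ℕ) : Qubits n :=
  WithLp.toLp 2 fun x : Bits n =>
    (∏ k : Fin (m : ℕ), singlet (x ⟨2 * (k : ℕ), by omega⟩) (x ⟨2 * (k : ℕ) + 1, by omega⟩)) *
    (if (Finset.univ.filter fun j : Fin n => 2 * (m : ℕ) ≤ (j : ℕ) ∧ x j = 1).card = q
      then 1 / (Real.sqrt ((n - 2 * (m : ℕ)).choose q : ℝ) : ℂ) else 0)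

/-- The matrix element `⟨u|A|v⟩`. -/
noncomputable def braket {n : ℕ} (u : Qubits n) (A : Op n) (v : Qubits n) : ℂ :=
  inner ℂ u (Matrix.toEuclideanLin A v)

/-- Labels `(λ, p, q)` of the Schur basis. -/
abbrev SchurIndex (n : ℕ) : Type :=
  Σ m : Fin (n / 2 + 1), Fin (multDim n m) × Fin (blockDim n m)

/-- A Schur basis: an orthonormal basis `|λ, p, q⟩` of the space of `n` qubits in which the
qubit-permuting representation takes the form `⨁_λ r_λ ⊗ 1`, with `r_λ` (acting on the label `p`)
irreducible and pairwise inequivalent, and which contains the canonical vectors, at the label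
`p0 λ`. -/
structure SchurBasis (n : ℕ) where
  basis : OrthonormalBasis (SchurIndex n) ℂ (Qubits n)
  irrep : (m : Fin (n / 2 + 1)) →
    Representation ℂ (Equiv.Perm (Fin n)) (Fin (multDim n m) → ℂ)
  irreducible : ∀ m, (irrep m).IsIrreducible
  inequivalent : ∀ m m', Nonempty ((irrep m).Equiv (irrep m')) → m = m'
  perm_apply : ∀ (σ : Equiv.Perm (Fin n)) (m : Fin (n / 2 + 1)) (p : Fin (multDim n m))
    (q : Fin (blockDim n m)),
    Matrix.toEuclideanLin (permOp σ) (basis ⟨m, p, q⟩) =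
      ∑ p' : Fin (multDim n m), irrep m σ (Pi.single p 1) p' • basis ⟨m, p', q⟩
  p0 : (m : Fin (n / 2 + 1)) → Fin (multDim n m)
  canonical : ∀ (m : Fin (n / 2 + 1)) (q : Fin (blockDim n m)),
    basis ⟨m, p0 m, q⟩ = canonicalVec n m q

/-- The block `A_λ` of an operator, in the canonical part of the Schur basis. -/
noncomputable def block {n : ℕ} (A : Op n) (m : Fin (n / 2 + 1)) :
    Matrix (Fin (blockDim n m)) (Fin (blockDim n m)) ℂ :=
  Matrix.of fun q q' => braket (canonicalVec n m q) A (canonicalVec n m q')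

/-- The irrep component `∑_p ρ_λ^p` of a state, summed over the multiplicity label. -/
noncomputable def stateComponent {n : ℕ} (S : SchurBasis n) (ρ : Op n) (m : Fin (n / 2 + 1)) :
    Matrix (Fin (blockDim n m)) (Fin (blockDim n m)) ℂ :=
  Matrix.of fun q q' =>
    ∑ p : Fin (multDim n m), braket (S.basis ⟨m, p, q⟩) ρ (S.basis ⟨m, p, q'⟩)

/-! ## The data given to the simulation -/

/-- Diagonalizations `(H_ℓ)_λ = Q_{ℓ,λ} Λ_{ℓ,λ} Q_{ℓ,λ}†` of all blocks of all generators, with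
`Q_{ℓ,λ}` unitary and `Λ_{ℓ,λ}` real diagonal. -/
structure Diagonalization {n L : ℕ} (H : Fin L → Op n) where
  Q : Fin L → (m : Fin (n / 2 + 1)) → Matrix (Fin (blockDim n m)) (Fin (blockDim n m)) ℂ
  eig : Fin L → (m : Fin (n / 2 + 1)) → Fin (blockDim n m) → ℝ
  unitary : ∀ (l : Fin L) (m : Fin (n / 2 + 1)),
    Q l m ∈ Matrix.unitaryGroup (Fin (blockDim n m)) ℂ
  block_eq : ∀ (l : Fin L) (m : Fin (n / 2 + 1)), block (H l) m =
    Q l m * Matrix.diagonal (fun q => (eig l m q : ℂ)) * (Q l m).conjTranspose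

def Pauli.code : Pauli → ℕ
  | .X => 0
  | .Y => 1
  | .Z => 2

def Obs.kindCode : Obs → ℕ
  | .oneLocal _ => 0
  | .twoLocal _ => 1
  | .global _ => 2

def Obs.pauliCode : Obs → ℕ
  | .oneLocal P => P.code
  | .twoLocal P => P.code
  | .global P => P.code

/-- The memory `s` holds the input of the simulation: `n`, `L` and the label of the observable in
the registers 0 to 3, the components of the state in array 0, and the diagonalized generators in
the arrays 1 and 2.  The rest of the memory is arbitrary. -/
structure HoldsInput {n L : ℕ} (s : State) (S : SchurBasis n) (ρ : Op n) {H : Fin L → Op n}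
    (D : Diagonalization H) (O : Obs) : Prop where
  size : s.nat 0 = n
  depth : s.nat 1 = L
  kind : s.nat 2 = O.kindCode
  pauli : s.nat 3 = O.pauliCode
  state : ∀ (m : Fin (n / 2 + 1)) (q q' : Fin (blockDim n m)),
    s.arr 0 [(m : ℕ), (q : ℕ), (q' : ℕ)] = stateComponent S ρ m q q'
  vectors : ∀ (l : Fin L) (m : Fin (n / 2 + 1)) (q q' : Fin (blockDim n m)),
    s.arr 1 [(l : ℕ), (m : ℕ), (q : ℕ), (q' : ℕ)] = D.Q l m q q'
  values : ∀ (l : Fin L) (m : Fin (n / 2 + 1)) (q : Fin (blockDim n m)),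
    s.arr 2 [(l : ℕ), (m : ℕ), (q : ℕ)] = (D.eig l m q : ℂ)

end SnSim

namespace SnSim

/-! ## Reasoning about programs -/

/-- The command `c` may assign the register `x`. -/
def Cmd.SetsReg (x : ℕ) : Cmd → Prop
  | .skip => False
  | .setNat y _ => x = y
  | .write _ _ _ => False
  | .seq c d => c.SetsReg x ∨ d.SetsReg x
  | .ite _ _ c d => c.SetsReg x ∨ d.SetsReg x
  | .loop _ _ c => c.SetsReg x

/-- The command `c` may write to the array `a`. -/
def Cmd.SetsArr (a : ℕ) : Cmd → Prop
  | .skip => False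
  | .setNat _ _ => False
  | .write b _ _ => a = b
  | .seq c d => c.SetsArr a ∨ d.SetsArr a
  | .ite _ _ c d => c.SetsArr a ∨ d.SetsArr a
  | .loop _ _ c => c.SetsArr a

/-- The two states differ at most in the registers and arrays that `c` may change. -/
def Agree (c : Cmd) (s s' : State) : Prop :=
  (∀ x, ¬ c.SetsReg x → s'.nat x = s.nat x) ∧ ∀ a, ¬ c.SetsArr a → s'.arr a = s.arr a

theorem Agree.refl (c : Cmd) (s : State) : Agree c s s := ⟨fun _ _ => rfl, fun _ _ => rfl⟩

theorem Agree.trans {c : Cmd} {s s' s'' : State} (h : Agree c s s') (h' : Agree c s' s'') :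
    Agree c s s'' :=
  ⟨fun x hx => (h'.1 x hx).trans (h.1 x hx), fun a ha => (h'.2 a ha).trans (h.2 a ha)⟩

theorem Agree.mono {c d : Cmd} {s s' : State} (h : Agree c s s')
    (hr : ∀ x, c.SetsReg x → d.SetsReg x) (ha : ∀ a, c.SetsArr a → d.SetsArr a) : Agree d s s' :=
  ⟨fun x hx => h.1 x fun hc => hx (hr x hc), fun a hx => h.2 a fun hc => hx (ha a hc)⟩

theorem Run.agree {c : Cmd} {s s' : State} {t : ℕ} (h : Run c s t s') : Agree c s s' := by
  induction h with
  | skip s => exact Agree.refl _ _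
  | setNat x e s =>
    refine ⟨fun y hy => ?_, fun _ _ => rfl⟩
    exact Function.update_of_ne hy _ _
  | write a idx e s =>
    refine ⟨fun _ _ => rfl, fun b hb => ?_⟩
    exact Function.update_of_ne hb _ _
  | seq _ _ ih₁ ih₂ =>
    exact (ih₁.mono (fun _ => Or.inl) fun _ => Or.inl).trans
      (ih₂.mono (fun _ => Or.inr) fun _ => Or.inr)
  | iteTrue _ _ ih => exact ih.mono (fun _ => Or.inl) fun _ => Or.inl
  | iteFalse _ _ ih => exact ih.mono (fun _ => Or.inr) fun _ => Or.inr
  | loopTrue _ _ _ ih₁ ih₂ => exact Agree.trans (ih₁.mono (fun _ h => h) fun _ h => h) ih₂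
  | loopFalse _ => exact Agree.refl _ _

/-- A run changes at most as many array entries as it takes units of time. -/
theorem Run.exists_finset {c : Cmd} {s s' : State} {t : ℕ} (h : Run c s t s') :
    ∃ F : Finset (ℕ × List ℕ), F.card ≤ t ∧ ∀ a idx, (a, idx) ∉ F → s'.arr a idx = s.arr a idx := by
  classical
  induction h with
  | skip s => exact ⟨∅, by simp, fun _ _ _ => rfl⟩
  | setNat x e s => exact ⟨∅, by simp, fun _ _ _ => rfl⟩
  | write a idx e s =>
    refine ⟨{(a, idx.map (NExp.eval s))}, by simp, fun b idx' hb => ?_⟩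
    by_cases hab : b = a
    · subst hab
      have : idx' ≠ idx.map (NExp.eval s) := by rintro rfl; simp at hb
      simp [Function.update_of_ne this]
    · simp [Function.update_of_ne hab]
  | seq _ _ ih₁ ih₂ =>
    obtain ⟨F, hF, h₁⟩ := ih₁
    obtain ⟨G, hG, h₂⟩ := ih₂
    refine ⟨F ∪ G, (Finset.card_union_le _ _).trans (by omega), fun a idx hn => ?_⟩
    rw [Finset.notMem_union] at hn
    rw [h₂ _ _ hn.2, h₁ _ _ hn.1]
  | iteTrue _ _ ih => obtain ⟨F, hF, h⟩ := ih; exact ⟨F, by omega, h⟩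
  | iteFalse _ _ ih => obtain ⟨F, hF, h⟩ := ih; exact ⟨F, by omega, h⟩
  | loopTrue _ _ _ ih₁ ih₂ =>
    obtain ⟨F, hF, h₁⟩ := ih₁
    obtain ⟨G, hG, h₂⟩ := ih₂
    refine ⟨F ∪ G, (Finset.card_union_le _ _).trans (by omega), fun a idx hn => ?_⟩
    rw [Finset.notMem_union] at hn
    rw [h₂ _ _ hn.2, h₁ _ _ hn.1]
  | loopFalse _ => exact ⟨∅, by simp, fun _ _ _ => rfl⟩

/-- Writing the product takes quadratic time. -/
theorem IsMatMulExponent.two_le {ω : ℝ} (hω : IsMatMulExponent ω) : 2 ≤ ω := by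
  obtain ⟨P, C, h⟩ := hω
  by_contra! hlt
  have key : ∀ d : ℕ, 1 ≤ d → (d : ℝ) ^ (2 - ω) ≤ C := by
    intro d hd
    obtain ⟨t, s', hrun, hres, ht⟩ := h d hd 0 0
      ⟨fun _ => d, fun a _ => if a = 2 then 1 else 0⟩ rfl (by simp) (by simp)
    obtain ⟨F, hF, hsame⟩ := hrun.exists_finset
    have hcard : d * d ≤ F.card := by
      have := Finset.card_le_card_of_injOn (s := (Finset.univ : Finset (Fin d × Fin d))) (t := F)
        (fun p => (2, [(p.1 : ℕ), (p.2 : ℕ)]))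
        (by
          intro p _
          by_contra hp
          have h1 := hsame _ _ hp
          rw [hres] at h1
          simp at h1)
        (by
          rintro ⟨i, j⟩ _ ⟨i', j'⟩ _ heq
          simp only [Prod.mk.injEq, List.cons.injEq] at heq
          ext <;> simp [heq])
      simpa using this
    have hd0 : (0 : ℝ) < d := by exact_mod_cast hd
    have h2 : (d : ℝ) ^ (2 : ℝ) ≤ C * (d : ℝ) ^ ω := by
      refine le_trans ?_ ht
      rw [Real.rpow_two, sq]
      exact_mod_cast hcard.trans hF
    rw [Real.rpow_sub hd0, div_le_iff₀ (Real.rpow_pos_of_pos hd0 _)]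
    exact h2
  have htend := (tendsto_rpow_atTop (sub_pos.2 hlt)).comp (tendsto_natCast_atTop_atTop (R := ℝ))
  obtain ⟨d, hd, hd'⟩ := ((htend.eventually_gt_atTop C).and
    (Filter.eventually_ge_atTop 1)).exists
  exact absurd (key d hd') (not_le.2 hd)

/-! ### Moving a program to other registers and arrays -/

def NExp.shift (K : ℕ) : NExp → NExp
  | .const k => .const k
  | .reg x => .reg (x + K)
  | .add a b => .add (a.shift K) (b.shift K)
  | .sub a b => .sub (a.shift K) (b.shift K)

def CExp.shift (K : ℕ) : CExp → CExp
  | .ofNat e => .ofNat (e.shift K)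
  | .imag => .imag
  | .read a idx => .read (a + K) (idx.map (NExp.shift K))
  | .add a b => .add (a.shift K) (b.shift K)
  | .sub a b => .sub (a.shift K) (b.shift K)
  | .mul a b => .mul (a.shift K) (b.shift K)
  | .div a b => .div (a.shift K) (b.shift K)
  | .conj a => .conj (a.shift K)
  | .exp a => .exp (a.shift K)
  | .sqrt a => .sqrt (a.shift K)

def Cmd.shift (K : ℕ) : Cmd → Cmd
  | .skip => .skip
  | .setNat x e => .setNat (x + K) (e.shift K)
  | .write a idx e => .write (a + K) (idx.map (NExp.shift K)) (e.shift K)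
  | .seq c d => .seq (c.shift K) (d.shift K)
  | .ite a b c d => .ite (a.shift K) (b.shift K) (c.shift K) (d.shift K)
  | .loop a b c => .loop (a.shift K) (b.shift K) (c.shift K)

/-- The part of the memory that a program shifted by `K` can see. -/
def State.drop (K : ℕ) (s : State) : State := ⟨fun x => s.nat (x + K), fun a => s.arr (a + K)⟩

theorem NExp.eval_shift (K : ℕ) (s : State) (e : NExp) : (e.shift K).eval s = e.eval (s.drop K) := by
  induction e with
  | const k => rfl
  | reg x => rfl
  | add a b iha ihb => simp [NExp.shift, NExp.eval, iha, ihb]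
  | sub a b iha ihb => simp [NExp.shift, NExp.eval, iha, ihb]

theorem NExp.cost_shift (K : ℕ) (e : NExp) : (e.shift K).cost = e.cost := by
  induction e with
  | const k => rfl
  | reg x => rfl
  | add a b iha ihb => simp [NExp.shift, NExp.cost, iha, ihb]
  | sub a b iha ihb => simp [NExp.shift, NExp.cost, iha, ihb]

theorem NExp.map_eval_shift (K : ℕ) (s : State) (l : List NExp) :
    (l.map (NExp.shift K)).map (NExp.eval s) = l.map (NExp.eval (s.drop K)) := by
  simp [NExp.eval_shift]

theorem NExp.map_cost_shift (K : ℕ) (l : List NExp) :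
    (l.map (NExp.shift K)).map NExp.cost = l.map NExp.cost := by
  simp [NExp.cost_shift]

theorem CExp.eval_shift (K : ℕ) (s : State) (e : CExp) : (e.shift K).eval s = e.eval (s.drop K) := by
  induction e with
  | ofNat e => simp [CExp.shift, CExp.eval, NExp.eval_shift]
  | imag => rfl
  | read a idx => simp only [CExp.shift, CExp.eval, NExp.map_eval_shift]; rfl
  | _ => simp_all [CExp.shift, CExp.eval]

theorem CExp.cost_shift (K : ℕ) (e : CExp) : (e.shift K).cost = e.cost := by
  induction e with
  | ofNat e => simp [CExp.shift, CExp.cost, NExp.cost_shift]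
  | imag => rfl
  | read a idx => simp only [CExp.shift, CExp.cost, NExp.map_cost_shift]
  | _ => simp_all [CExp.shift, CExp.cost]

theorem Run.shift {c : Cmd} {s₀ s₀' : State} {t : ℕ} (K : ℕ) (h : Run c s₀ t s₀') :
    ∀ s : State, s.drop K = s₀ → ∃ s', Run (c.shift K) s t s' ∧ s'.drop K = s₀' := by
  induction h with
  | skip _ => exact fun s hs => ⟨s, .skip s, hs⟩
  | setNat x e _ =>
    rintro s rfl
    have h := Run.setNat (x + K) (e.shift K) s
    rw [NExp.cost_shift, NExp.eval_shift] at h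
    refine ⟨_, h, ?_⟩
    simp only [State.drop, State.mk.injEq, and_true]
    funext y
    simp [Function.update_apply]
  | write a idx e _ =>
    rintro s rfl
    have h := Run.write (a + K) (idx.map (NExp.shift K)) (e.shift K) s
    rw [CExp.cost_shift, CExp.eval_shift, NExp.map_cost_shift, NExp.map_eval_shift] at h
    refine ⟨_, h, ?_⟩
    simp only [State.drop, State.mk.injEq, true_and]
    funext y
    simp [Function.update_apply]
  | seq _ _ ih₁ ih₂ =>
    intro s hs
    obtain ⟨s', h₁, hs'⟩ := ih₁ s hs
    obtain ⟨s'', h₂, hs''⟩ := ih₂ s' hs'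
    exact ⟨s'', .seq h₁ h₂, hs''⟩
  | @iteTrue a b _ _ _ _ _ h _ ih =>
    rintro s rfl
    obtain ⟨s', h₁, hs'⟩ := ih s rfl
    rw [← a.cost_shift K, ← b.cost_shift K]
    exact ⟨s', .iteTrue (by simpa only [NExp.eval_shift] using h) h₁, hs'⟩
  | @iteFalse a b _ _ _ _ _ h _ ih =>
    rintro s rfl
    obtain ⟨s', h₁, hs'⟩ := ih s rfl
    rw [← a.cost_shift K, ← b.cost_shift K]
    exact ⟨s', .iteFalse (by simpa only [NExp.eval_shift] using h) h₁, hs'⟩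
  | @loopTrue a b _ _ _ _ _ _ h _ _ ih₁ ih₂ =>
    rintro s rfl
    obtain ⟨s', h₁, hs'⟩ := ih₁ s rfl
    obtain ⟨s'', h₂, hs''⟩ := ih₂ s' hs'
    rw [← a.cost_shift K, ← b.cost_shift K]
    exact ⟨s'', .loopTrue (by simpa only [NExp.eval_shift] using h) h₁ h₂, hs''⟩
  | @loopFalse a b _ _ h =>
    rintro s rfl
    rw [← a.cost_shift K, ← b.cost_shift K]
    exact ⟨s, .loopFalse (by simpa only [NExp.eval_shift] using h), rfl⟩

theorem Cmd.le_of_setsReg_shift {K x : ℕ} {c : Cmd} (h : (c.shift K).SetsReg x) : K ≤ x := by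
  induction c with
  | skip => exact h.elim
  | setNat y e => simp only [Cmd.shift, Cmd.SetsReg] at h; omega
  | write a idx e => exact h.elim
  | seq c d ihc ihd => exact h.elim ihc ihd
  | ite a b c d ihc ihd => exact h.elim ihc ihd
  | loop a b c ih => exact ih h

theorem Cmd.le_of_setsArr_shift {K x : ℕ} {c : Cmd} (h : (c.shift K).SetsArr x) : K ≤ x := by
  induction c with
  | skip => exact h.elim
  | setNat y e => exact h.elim
  | write a idx e => simp only [Cmd.shift, Cmd.SetsArr] at h; omega
  | seq c d ihc ihd => exact h.elim ihc ihd
  | ite a b c d ihc ihd => exact h.elim ihc ihd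
  | loop a b c ih => exact ih h

/-! ### Total correctness with a time bound -/

/-- Started in `s`, the program `c` halts within time `T` in a state with the property `Q`. -/
def Halts (c : Cmd) (s : State) (T : ℕ) (Q : State → Prop) : Prop :=
  ∃ (t : ℕ) (s' : State), Run c s t s' ∧ t ≤ T ∧ Agree c s s' ∧ Q s'

theorem Halts.mono {c : Cmd} {s : State} {T U : ℕ} {Q R : State → Prop} (h : Halts c s T Q)
    (hT : T ≤ U) (hQ : ∀ s', Agree c s s' → Q s' → R s') : Halts c s U R := by
  obtain ⟨t, s', hr, ht, ha, hq⟩ := h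
  exact ⟨t, s', hr, ht.trans hT, ha, hQ s' ha hq⟩

theorem Halts.seq {c d : Cmd} {s : State} {T U : ℕ} {Q R : State → Prop} (h : Halts c s T Q)
    (hd : ∀ s', Agree c s s' → Q s' → Halts d s' U R) : Halts (.seq c d) s (T + U) R := by
  obtain ⟨t, s', hr, ht, ha, hq⟩ := h
  obtain ⟨u, s'', hr', hu, ha', hq'⟩ := hd s' ha hq
  exact ⟨t + u, s'', .seq hr hr', by omega, (Run.seq hr hr').agree, hq'⟩

theorem halts_setNat (x : ℕ) (e : NExp) (s : State) :
    Halts (.setNat x e) s (e.cost + 1) fun s' => s'.nat x = e.eval s ∧ s'.arr = s.arr :=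
  ⟨_, _, .setNat x e s, le_rfl, (Run.setNat x e s).agree, by simp, rfl⟩

theorem halts_write (a : ℕ) (idx : List NExp) (e : CExp) (s : State) :
    Halts (.write a idx e) s ((idx.map NExp.cost).sum + e.cost + 1) fun s' =>
      s'.arr a = Function.update (s.arr a) (idx.map (NExp.eval s)) (e.eval s) :=
  ⟨_, _, .write a idx e s, le_rfl, (Run.write a idx e s).agree, by simp⟩

/-- The loop in which the register `r` runs over the numbers less than `b`. -/
def Cmd.for (r : ℕ) (b : NExp) (c : Cmd) : Cmd :=
  .seq (.setNat r (.const 0))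
    (.loop (.reg r) b (.seq c (.setNat r (.add (.reg r) (.const 1)))))

theorem Cmd.setsReg_for {x r : ℕ} {b : NExp} {c : Cmd} :
    (Cmd.for r b c).SetsReg x ↔ x = r ∨ c.SetsReg x := by
  simp only [Cmd.for, Cmd.SetsReg]; tauto

theorem Cmd.setsArr_for {a r : ℕ} {b : NExp} {c : Cmd} :
    (Cmd.for r b c).SetsArr a ↔ c.SetsArr a := by
  simp [Cmd.for, Cmd.SetsArr]

theorem halts_for {r : ℕ} {b : NExp} {c : Cmd} {s : State} {N T : ℕ}
    (I : ℕ → (ℕ → List ℕ → ℂ) → Prop) (hr : ¬ c.SetsReg r)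
    (hb : ∀ s', Agree (.for r b c) s s' → b.eval s' = N) (h0 : I 0 s.arr)
    (hs : ∀ k < N, ∀ s', Agree (.for r b c) s s' → s'.nat r = k → I k s'.arr →
      Halts c s' T fun s'' => I (k + 1) s''.arr) :
    Halts (.for r b c) s ((N + 1) * (T + b.cost + 6)) fun s' => I N s'.arr := by
  have hloop : ∀ j k, k + j = N → ∀ s', Agree (.for r b c) s s' → s'.nat r = k → I k s'.arr →
      ∃ t s'', Run (.loop (.reg r) b (.seq c (.setNat r (.add (.reg r) (.const 1))))) s' t s'' ∧
        t ≤ j * (T + b.cost + 6) + b.cost + 2 ∧ I N s''.arr := by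
    intro j
    induction j with
    | zero =>
      intro k hk s' ha hk' hI
      obtain rfl : k = N := by omega
      refine ⟨_, s', .loopFalse ?_, ?_, hI⟩
      · simp [NExp.eval, hk', hb s' ha]
      · simp [NExp.cost]; omega
    | succ j ih =>
      intro k hk s' ha hk' hI
      obtain ⟨t, s₁, hrun, ht, ha₁, hI₁⟩ := hs k (by omega) s' ha hk' hI
      have hinc := Run.setNat r (.add (.reg r) (.const 1)) s₁
      have hbody := Run.seq hrun hinc
      have ha₂ := ha.trans (hbody.agree.mono (d := .for r b c)
        (fun x hx => Cmd.setsReg_for.2 (by simp only [Cmd.SetsReg] at hx; tauto))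
        (fun x hx => Cmd.setsArr_for.2 (by simp only [Cmd.SetsArr] at hx; tauto)))
      obtain ⟨u, s'', hl, hu, hN⟩ := ih (k + 1) (by omega) _ ha₂
        (by simp [NExp.eval, ha₁.1 r hr, hk']) hI₁
      refine ⟨_, s'', .loopTrue ?_ hbody hl, ?_, hN⟩
      · simp only [NExp.eval, hk', hb s' ha]; omega
      · simp only [NExp.cost]
        rw [Nat.succ_mul]
        omega
  have hinit := Run.setNat r (.const 0) s
  obtain ⟨t, s', hl, ht, hI⟩ := hloop N 0 (by omega) _
    (hinit.agree.mono (d := .for r b c)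
        (fun x hx => Cmd.setsReg_for.2 (by simp only [Cmd.SetsReg] at hx; tauto))
        (fun x hx => hx.elim)) (by simp [NExp.eval]) h0
  refine ⟨_, s', .seq hinit hl, ?_, (Run.seq hinit hl).agree, hI⟩
  simp only [NExp.cost]
  rw [Nat.succ_mul]
  omega

/-- The array `f` holds the matrix `M`. -/
def IsMat {d : ℕ} (f : List ℕ → ℂ) (M : Matrix (Fin d) (Fin d) ℂ) : Prop :=
  ∀ i j : Fin d, f [(i : ℕ), (j : ℕ)] = M i j

/-- The double loop in which the registers 7 and 8 run over the numbers less than register 5. -/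
def Cmd.forIdx (c : Cmd) : Cmd := .for 7 (.reg 5) (.for 8 (.reg 5) c)

theorem Cmd.setsReg_forIdx {x : ℕ} {c : Cmd} :
    (Cmd.forIdx c).SetsReg x ↔ x = 7 ∨ x = 8 ∨ c.SetsReg x := by
  simp only [Cmd.forIdx, Cmd.setsReg_for]

theorem Cmd.setsArr_forIdx {a : ℕ} {c : Cmd} :
    (Cmd.forIdx c).SetsArr a ↔ c.SetsArr a := by
  simp only [Cmd.forIdx, Cmd.setsArr_for]

theorem halts_forIdx {c : Cmd} {s : State} {d T : ℕ}
    (I : ℕ → ℕ → (ℕ → List ℕ → ℂ) → Prop)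
    (h5 : ¬ c.SetsReg 5) (h7 : ¬ c.SetsReg 7) (h8 : ¬ c.SetsReg 8) (hd : s.nat 5 = d)
    (h0 : I 0 0 s.arr) (hI : ∀ i < d, ∀ f, I i d f → I (i + 1) 0 f)
    (hs : ∀ i < d, ∀ j < d, ∀ s', Agree (.forIdx c) s s' → s'.nat 7 = i → s'.nat 8 = j →
      I i j s'.arr → Halts c s' T fun s'' => I i (j + 1) s''.arr) :
    Halts (.forIdx c) s ((d + 1) * ((d + 1) * (T + 14))) fun s' => I d 0 s'.arr := by
  have hmono : ∀ {s₁ s₂ : State}, Agree (.for 8 (.reg 5) c) s₁ s₂ → Agree (.forIdx c) s₁ s₂ :=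
    fun h => h.mono
      (fun x hx => Cmd.setsReg_forIdx.2 (Or.inr (Cmd.setsReg_for.1 hx)))
      (fun x hx => Cmd.setsArr_forIdx.2 (Cmd.setsArr_for.1 hx))
  have h5' : ∀ {s'}, Agree (.forIdx c) s s' → s'.nat 5 = d := fun ha => by
    rw [ha.1 5 (by rw [Cmd.setsReg_forIdx]; simp [h5]), hd]
  have := halts_for (r := 7) (b := .reg 5) (c := .for 8 (.reg 5) c) (s := s) (N := d)
    (T := (d + 1) * (T + 7)) (fun i => I i 0)
    (by rw [Cmd.setsReg_for]; simp [h7]) (fun s' ha => h5' ha) h0 ?_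
  · refine this.mono ?_ fun _ _ h => h
    refine Nat.mul_le_mul_left _ ?_
    simp only [NExp.cost]
    nlinarith
  · intro i hi s' ha hi' hI'
    refine (halts_for (N := d) (T := T) (I i) h8 (fun s'' ha' => h5' (ha.trans (hmono ha')))
      hI' ?_).mono le_rfl fun s'' _ h => hI i hi _ h
    intro j hj s'' ha' hj' hI''
    refine hs i hi j hj s'' (ha.trans (hmono ha')) ?_ hj' hI''
    rw [ha'.1 7 (by rw [Cmd.setsReg_for]; simp [h7]), hi']

/-- Fill the array `a` with the values of `e`. -/
def Cmd.fill (a : ℕ) (e : CExp) : Cmd := .forIdx (.write a [.reg 7, .reg 8] e)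

theorem Cmd.setsReg_fill {x a : ℕ} {e : CExp} :
    (Cmd.fill a e).SetsReg x ↔ x = 7 ∨ x = 8 := by
  simp [Cmd.fill, Cmd.setsReg_forIdx, Cmd.SetsReg]

theorem Cmd.setsArr_fill {x a : ℕ} {e : CExp} :
    (Cmd.fill a e).SetsArr x ↔ x = a := by
  simp [Cmd.fill, Cmd.setsArr_forIdx, Cmd.SetsArr]

theorem halts_fill {a : ℕ} {e : CExp} {s : State} {d : ℕ} (M : Matrix (Fin d) (Fin d) ℂ)
    (hd : s.nat 5 = d)
    (h : ∀ (i j : Fin d) (s' : State), Agree (.fill a e) s s' → s'.nat 7 = i → s'.nat 8 = j →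
      e.eval s' = M i j) :
    Halts (.fill a e) s ((d + 1) * ((d + 1) * (e.cost + 17))) fun s' => IsMat (s'.arr a) M := by
  have := halts_forIdx (c := .write a [.reg 7, .reg 8] e) (s := s) (d := d) (T := e.cost + 3)
    (fun i j f => ∀ i' j' : Fin d, ((i' : ℕ) < i ∨ (i' : ℕ) = i ∧ (j' : ℕ) < j) →
      f a [(i' : ℕ), (j' : ℕ)] = M i' j')
    id id id hd (by intro i' j'; omega) ?_ ?_
  · exact this.mono (by simp [add_assoc]) fun s' _ h i j => h i j (Or.inl i.2)
  · intro i hi f hf i' j' hij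
    refine hf i' j' ?_
    have := j'.2
    omega
  · intro i hi j hj s' ha hi' hj' hI
    refine (halts_write _ _ _ _).mono (by simp [NExp.cost]; omega) fun s'' _ hs'' i' j' hij => ?_
    rw [hs'', h ⟨i, hi⟩ ⟨j, hj⟩ s' ha hi' hj']
    simp only [List.map_cons, List.map_nil, NExp.eval, hi', hj']
    by_cases heq : (i' : ℕ) = i ∧ (j' : ℕ) = j
    · obtain ⟨rfl, rfl⟩ := heq
      simp
    · rw [Function.update_of_ne]
      · exact hI i' j' (by omega)
      · simpa using heq

/-- Add the sum of the values of `e` to the result. -/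
def Cmd.accum (e : CExp) : Cmd := .forIdx (.write 3 [] (.add (.read 3 []) e))

theorem Cmd.setsReg_accum {x : ℕ} {e : CExp} :
    (Cmd.accum e).SetsReg x ↔ x = 7 ∨ x = 8 := by
  simp [Cmd.accum, Cmd.setsReg_forIdx, Cmd.SetsReg]

theorem Cmd.setsArr_accum {x : ℕ} {e : CExp} :
    (Cmd.accum e).SetsArr x ↔ x = 3 := by
  simp [Cmd.accum, Cmd.setsArr_forIdx, Cmd.SetsArr]

theorem halts_accum {e : CExp} {s : State} {d : ℕ} (M : Matrix (Fin d) (Fin d) ℂ)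
    (hd : s.nat 5 = d)
    (h : ∀ (i j : Fin d) (s' : State), Agree (.accum e) s s' → s'.nat 7 = i → s'.nat 8 = j →
      e.eval s' = M i j) :
    Halts (.accum e) s ((d + 1) * ((d + 1) * (e.cost + 17))) fun s' =>
      s'.arr 3 [] = s.arr 3 [] + ∑ i, ∑ j, M i j := by
  set g : ℕ → ℕ → ℂ := fun i j => if hij : i < d ∧ j < d then M ⟨i, hij.1⟩ ⟨j, hij.2⟩ else 0 with hg
  have hsum : ∑ i, ∑ j, M i j = ∑ i ∈ Finset.range d, ∑ j ∈ Finset.range d, g i j := by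
    rw [← Fin.sum_univ_eq_sum_range (fun i => ∑ j ∈ Finset.range d, g i j)]
    refine Finset.sum_congr rfl fun i _ => ?_
    rw [← Fin.sum_univ_eq_sum_range (fun j => g i j)]
    exact Finset.sum_congr rfl fun j _ => by simp [hg]
  have := halts_forIdx (c := .write 3 [] (.add (.read 3 []) e)) (s := s) (d := d) (T := e.cost + 3)
    (fun i j f => f 3 [] = s.arr 3 [] + ((∑ i' ∈ Finset.range i, ∑ j' ∈ Finset.range d, g i' j')
      + ∑ j' ∈ Finset.range j, g i j'))
    id id id hd (by simp) ?_ ?_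
  · refine this.mono (by simp [add_assoc]) fun s' _ h => ?_
    rw [h, hsum]
    simp
  · intro i hi f hf
    rw [hf, Finset.sum_range_succ]
    simp
  · intro i hi j hj s' ha hi' hj' hI
    refine (halts_write _ _ _ _).mono (by simp [CExp.cost]; omega) fun s'' _ hs'' => ?_
    rw [hs'']
    simp only [List.map_nil, Function.update_self, CExp.eval]
    rw [hI, h ⟨i, hi⟩ ⟨j, hj⟩ s' ha hi' hj', Finset.sum_range_succ (fun j' => g i j')]
    simp [hg, hi, hj, add_assoc]

/-- Fill the arrays 32 and 33 with the values of `e` and `e'`. -/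
def Cmd.load (e e' : CExp) : Cmd := .seq (.fill 32 e) (.fill 33 e')

theorem Cmd.setsReg_load {x : ℕ} {e e' : CExp} : (Cmd.load e e').SetsReg x ↔ x = 7 ∨ x = 8 := by
  simp [Cmd.load, Cmd.SetsReg, Cmd.setsReg_fill]

theorem Cmd.setsArr_load {x : ℕ} {e e' : CExp} :
    (Cmd.load e e').SetsArr x ↔ x = 32 ∨ x = 33 := by
  simp [Cmd.load, Cmd.SetsArr, Cmd.setsArr_fill]

/-- Matrix multiplication by the program `P`, working in the registers and arrays from 32 on: the
array `c` receives the product of the matrices with the entries `e` and `e'`. -/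
def Cmd.matMul (P : Cmd) (e e' : CExp) (c : ℕ) : Cmd :=
  .seq (.load e e') <| .seq (.setNat 32 (.reg 5)) <|
    .seq (P.shift 32) (.fill c (.read 34 [.reg 7, .reg 8]))

theorem Cmd.setsReg_matMul {P : Cmd} {x c : ℕ} {e e' : CExp} (h : (Cmd.matMul P e e' c).SetsReg x) :
    x = 7 ∨ x = 8 ∨ 32 ≤ x := by
  simp only [Cmd.matMul, Cmd.SetsReg, Cmd.setsReg_load, Cmd.setsReg_fill] at h
  rcases h with h | h | h | h
  · omega
  · omega
  · have := Cmd.le_of_setsReg_shift h; omega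
  · omega

theorem Cmd.setsArr_matMul {P : Cmd} {x c : ℕ} {e e' : CExp} (h : (Cmd.matMul P e e' c).SetsArr x) :
    x = c ∨ 32 ≤ x := by
  simp only [Cmd.matMul, Cmd.SetsArr, Cmd.setsArr_load, Cmd.setsArr_fill] at h
  rcases h with h | h | h | h
  · omega
  · exact h.elim
  · have := Cmd.le_of_setsArr_shift h; omega
  · omega

/-- `P` multiplies `d × d` matrices within time `T`. -/
def MultipliesIn (P : Cmd) (d T : ℕ) : Prop :=
  ∀ (A B : Matrix (Fin d) (Fin d) ℂ) (s : State), s.nat 0 = d → IsMat (s.arr 0) A →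
    IsMat (s.arr 1) B → ∃ (t : ℕ) (s' : State), Run P s t s' ∧ IsMat (s'.arr 2) (A * B) ∧ t ≤ T

theorem halts_matMul {P : Cmd} {e e' : CExp} {c : ℕ} {s : State} {d T : ℕ}
    (hc : c < 32) (hP : MultipliesIn P d T) (A B : Matrix (Fin d) (Fin d) ℂ) (hd : s.nat 5 = d)
    (hA : ∀ (i j : Fin d) (s' : State), Agree (.load e e') s s' → s'.nat 7 = i →
      s'.nat 8 = j → e.eval s' = A i j)
    (hB : ∀ (i j : Fin d) (s' : State), Agree (.load e e') s s' → s'.nat 7 = i →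
      s'.nat 8 = j → e'.eval s' = B i j) :
    Halts (.matMul P e e' c) s (T + (d + 1) * ((d + 1) * (e.cost + e'.cost + 60))) fun s' =>
      IsMat (s'.arr c) (A * B) := by
  have h1 : ∀ {s₁ s₂ : State}, Agree (.fill 32 e) s₁ s₂ → Agree (.load e e') s₁ s₂ :=
    fun h => h.mono (fun x hx => Or.inl hx) (fun x hx => Or.inl hx)
  have h2 : ∀ {s₁ s₂ : State}, Agree (.fill 33 e') s₁ s₂ → Agree (.load e e') s₁ s₂ :=
    fun h => h.mono (fun x hx => Or.inr hx) (fun x hx => Or.inr hx)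
  have hload : Halts (.load e e') s ((d + 1) * ((d + 1) * (e.cost + 17)) +
      (d + 1) * ((d + 1) * (e'.cost + 17))) fun s' => IsMat (s'.arr 32) A ∧ IsMat (s'.arr 33) B := by
    refine Halts.seq (halts_fill A hd fun i j s' ha => hA i j s' (h1 ha)) fun s₁ a₁ q₁ => ?_
    have d₁ : s₁.nat 5 = d := by rw [a₁.1 5 (by simp [Cmd.setsReg_fill]), hd]
    refine (halts_fill B d₁ fun i j s' ha => hB i j s' ((h1 a₁).trans (h2 ha))).mono le_rfl
      fun s₂ a₂ q₂ => ⟨?_, q₂⟩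
    rw [a₂.2 32 (by simp [Cmd.setsArr_fill])]
    exact q₁
  have key : Halts (.matMul P e e' c) s ((d + 1) * ((d + 1) * (e.cost + 17)) +
      (d + 1) * ((d + 1) * (e'.cost + 17)) + (2 + (T + (d + 1) * ((d + 1) * 20)))) fun s' =>
      IsMat (s'.arr c) (A * B) := by
    refine Halts.seq hload fun s₂ a₂ q₂ => ?_
    have d₂ : s₂.nat 5 = d := by rw [a₂.1 5 (by simp [Cmd.setsReg_load]), hd]
    refine Halts.seq (halts_setNat _ _ _) fun s₃ a₃ q₃ => ?_
    have d₃ : s₃.nat 5 = d := by rw [a₃.1 5 (by simp [Cmd.SetsReg]), d₂]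
    obtain ⟨t, s₄', hrun, hres, ht⟩ := hP A B (s₃.drop 32)
      (by simp [State.drop, q₃.1, NExp.eval, d₂])
      (by simp only [State.drop, q₃.2]; exact q₂.1)
      (by simp only [State.drop, q₃.2]; exact q₂.2)
    obtain ⟨s₄, hrun₄, hs₄⟩ := hrun.shift 32 s₃ rfl
    have hH : Halts (P.shift 32) s₃ T fun s' => IsMat (s'.arr 34) (A * B) :=
      ⟨t, s₄, hrun₄, ht, hrun₄.agree, by rw [← hs₄] at hres; exact hres⟩
    refine Halts.seq hH fun s₅ a₅ q₅ => ?_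
    have d₅ : s₅.nat 5 = d := by
      rw [a₅.1 5 (fun h => by have := Cmd.le_of_setsReg_shift h; omega), d₃]
    refine halts_fill (A * B) d₅ fun i j s' ha hi hj => ?_
    simp only [CExp.eval, List.map_cons, List.map_nil, NExp.eval, hi, hj]
    rw [ha.2 34 (by simp [Cmd.setsArr_fill]; omega)]
    exact q₅ i j
  refine key.mono ?_ fun _ _ h => h
  nlinarith

/-! ## The blocks of equivariant operators -/

theorem toEuclideanLin_mul {n : ℕ} (A B : Op n) (v : Qubits n) :
    Matrix.toEuclideanLin (A * B) v = Matrix.toEuclideanLin A (Matrix.toEuclideanLin B v) := by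
  simp [Matrix.toLpLin_apply, Matrix.mulVec_mulVec]

theorem inner_conjTranspose {n : ℕ} (A : Op n) (u v : Qubits n) :
    inner ℂ u (Matrix.toEuclideanLin A.conjTranspose v) =
      inner ℂ (Matrix.toEuclideanLin A u) v := by
  rw [Matrix.toEuclideanLin_conjTranspose_eq_adjoint, LinearMap.adjoint_inner_right]

theorem toEuclideanLin_exp {n : ℕ} {A : Op n} {v : Qubits n} {μ : ℂ}
    (h : Matrix.toEuclideanLin A v = μ • v) :
    Matrix.toEuclideanLin (NormedSpace.exp A) v = Complex.exp μ • v := by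
  let _ : NormedRing (Op n) := Matrix.linftyOpNormedRing
  let _ : NormedAlgebra ℂ (Op n) := Matrix.linftyOpNormedAlgebra
  have hpow : ∀ k : ℕ, Matrix.toEuclideanLin (A ^ k) v = μ ^ k • v := by
    intro k
    induction k with
    | zero => simp
    | succ k ih => rw [pow_succ, toEuclideanLin_mul, h, map_smul, ih, smul_smul, pow_succ']
  have h₁ := NormedSpace.exp_series_hasSum_exp' (𝕂 := ℂ) A
  have h₂ := NormedSpace.exp_series_hasSum_exp' (𝕂 := ℂ) μ
  let F : Op n →ₗ[ℂ] Qubits n :=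
    (LinearMap.applyₗ v) ∘ₗ (Matrix.toEuclideanLin : Op n ≃ₗ[ℂ] _).toLinearMap
  have h₃ := h₁.map F (LinearMap.continuous_of_finiteDimensional F)
  have h₄ := h₂.smul_const v
  rw [← Complex.exp_eq_exp_ℂ] at h₄
  refine h₃.unique ?_
  convert h₄ using 1
  funext k
  simp only [Function.comp, F, LinearMap.comp_apply, LinearMap.applyₗ_apply_apply,
    LinearEquiv.coe_coe, map_smul, hpow, smul_assoc]

variable {n : ℕ}

/-- In the Schur basis, `A` is the direct sum of the matrices `1 ⊗ B m`. -/
def HasBlocks (S : SchurBasis n) (A : Op n)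
    (B : (m : Fin (n / 2 + 1)) → Matrix (Fin (blockDim n m)) (Fin (blockDim n m)) ℂ) : Prop :=
  ∀ (m : Fin (n / 2 + 1)) (p : Fin (multDim n m)) (q' : Fin (blockDim n m)),
    Matrix.toEuclideanLin A (S.basis ⟨m, p, q'⟩) = ∑ q, B m q q' • S.basis ⟨m, p, q⟩

theorem SchurBasis.inner_basis (S : SchurBasis n) (m m' : Fin (n / 2 + 1)) (p : Fin (multDim n m))
    (p' : Fin (multDim n m')) (q : Fin (blockDim n m)) (q' : Fin (blockDim n m')) :
    inner ℂ (S.basis ⟨m, p, q⟩) (S.basis ⟨m', p', q'⟩) =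
      if (⟨m, p, q⟩ : SchurIndex n) = ⟨m', p', q'⟩ then 1 else 0 :=
  S.basis.inner_eq_ite _ _

namespace HasBlocks

variable {S : SchurBasis n} {A A' : Op n}
  {B B' : (m : Fin (n / 2 + 1)) → Matrix (Fin (blockDim n m)) (Fin (blockDim n m)) ℂ}

theorem one : HasBlocks S 1 fun _ => 1 := by
  intro m p q'
  simp [Matrix.one_apply, ite_smul]

theorem mul (h : HasBlocks S A B) (h' : HasBlocks S A' B') :
    HasBlocks S (A * A') fun m => B m * B' m := by
  intro m p q'
  rw [toEuclideanLin_mul, h', map_sum]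
  simp_rw [map_smul, h m p, Finset.smul_sum, Matrix.mul_apply, Finset.sum_smul]
  rw [Finset.sum_comm]
  simp_rw [smul_smul, mul_comm]

theorem add (h : HasBlocks S A B) (h' : HasBlocks S A' B') :
    HasBlocks S (A + A') fun m => B m + B' m := by
  intro m p q'
  simp only [map_add, LinearMap.add_apply, h m p, h' m p, Matrix.add_apply, add_smul,
    Finset.sum_add_distrib]

theorem smul (c : ℂ) (h : HasBlocks S A B) : HasBlocks S (c • A) fun m => c • B m := by
  intro m p q'
  simp only [map_smul, LinearMap.smul_apply, h m p, Matrix.smul_apply, Finset.smul_sum, smul_smul,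
    smul_eq_mul]

theorem conjTranspose (h : HasBlocks S A B) :
    HasBlocks S A.conjTranspose fun m => (B m).conjTranspose := by
  intro m p q'
  refine InnerProductSpace.ext_inner_left_basis (𝕜 := ℂ) S.basis.toBasis fun i => ?_
  obtain ⟨m₁, p₁, q₁⟩ := i
  rw [OrthonormalBasis.coe_toBasis, inner_conjTranspose, h m₁ p₁ q₁, sum_inner, inner_sum]
  simp_rw [inner_smul_left, inner_smul_right, S.inner_basis]
  by_cases hm : m₁ = m
  · subst hm
    by_cases hp : p₁ = p
    · subst hp
      simp [Matrix.conjTranspose_apply]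
    · simp [hp]
  · simp [hm]

theorem listProd {L : ℕ} {A : Fin L → Op n}
    {B : Fin L → (m : Fin (n / 2 + 1)) → Matrix (Fin (blockDim n m)) (Fin (blockDim n m)) ℂ}
    (h : ∀ l, HasBlocks S (A l) (B l)) :
    HasBlocks S (List.ofFn A).prod fun m => (List.ofFn fun l => B l m).prod := by
  induction L with
  | zero => simpa using one
  | succ L ih =>
    simp only [List.ofFn_succ, List.prod_cons]
    exact (h 0).mul (ih fun l => h l.succ)

theorem exp {Q : (m : Fin (n / 2 + 1)) → Matrix (Fin (blockDim n m)) (Fin (blockDim n m)) ℂ}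
    {lam : (m : Fin (n / 2 + 1)) → Fin (blockDim n m) → ℂ}
    (hQ : ∀ m : Fin (n / 2 + 1), Q m ∈ Matrix.unitaryGroup (Fin (blockDim n m)) ℂ)
    (h : HasBlocks S A fun m => Q m * Matrix.diagonal (lam m) * (Q m).conjTranspose) :
    HasBlocks S (NormedSpace.exp A) fun m =>
      Q m * Matrix.diagonal (fun q => Complex.exp (lam m q)) * (Q m).conjTranspose := by
  intro m p q'
  have hQ₁ : (Q m).conjTranspose * Q m = 1 := (Matrix.mem_unitaryGroup_iff'.1 (hQ m))
  have hQ₂ : Q m * (Q m).conjTranspose = 1 := (Matrix.mem_unitaryGroup_iff.1 (hQ m))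
  set w : Fin (blockDim n m) → Qubits n := fun r => ∑ q, Q m q r • S.basis ⟨m, p, q⟩ with hw
  have comb : ∀ (M : Matrix (Fin (blockDim n m)) (Fin (blockDim n m)) ℂ) (r : Fin (blockDim n m)),
      ∑ q, M q r • w q = ∑ q, (Q m * M) q r • S.basis ⟨m, p, q⟩ := by
    intro M r
    simp only [hw, Finset.smul_sum, Matrix.mul_apply, Finset.sum_smul, smul_smul]
    rw [Finset.sum_comm]
    simp_rw [mul_comm]
  have heig : ∀ r, Matrix.toEuclideanLin A (w r) = lam m r • w r := by
    intro r
    have h₁ : Matrix.toEuclideanLin A (w r) =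
        ∑ q, (Q m * (Matrix.diagonal (lam m) * (Q m).conjTranspose * Q m)) q r •
          S.basis ⟨m, p, q⟩ := by
      simp only [hw, map_sum, map_smul, h m p, Finset.smul_sum]
      rw [Finset.sum_comm]
      refine Finset.sum_congr rfl fun q _ => ?_
      rw [← Matrix.mul_assoc, ← Matrix.mul_assoc, Matrix.mul_apply, Finset.sum_smul]
      simp_rw [smul_smul, mul_comm]
    rw [h₁, ← comb, Matrix.mul_assoc, hQ₁, Matrix.mul_one]
    simp [Matrix.diagonal_apply, ite_smul]
  have hexp : ∀ r, Matrix.toEuclideanLin (NormedSpace.exp A) (w r) =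
      Complex.exp (lam m r) • w r := fun r => toEuclideanLin_exp (heig r)
  have hb : S.basis ⟨m, p, q'⟩ = ∑ q, (Q m).conjTranspose q q' • w q := by
    rw [comb, hQ₂]
    simp [Matrix.one_apply, ite_smul]
  beta_reduce
  rw [hb, map_sum, Matrix.mul_assoc, ← comb]
  refine Finset.sum_congr rfl fun r _ => ?_
  rw [map_smul, hexp, smul_smul, Matrix.diagonal_mul, mul_comm]

end HasBlocks

/-- Schur's lemma: matrix elements of equivariant operators. -/
theorem IsEquivariant.hasBlocks {A : Op n} (hA : IsEquivariant A) (S : SchurBasis n) :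
    HasBlocks S A (block A) := by
  set c : SchurIndex n → SchurIndex n → ℂ := fun i i' =>
    inner ℂ (S.basis i) (Matrix.toEuclideanLin A (S.basis i')) with hc
  have hcomm : ∀ (σ : Equiv.Perm (Fin n)) (m m' : Fin (n / 2 + 1)) (p : Fin (multDim n m))
      (p' : Fin (multDim n m')) (q : Fin (blockDim n m)) (q' : Fin (blockDim n m')),
      ∑ p'', S.irrep m' σ (Pi.single p' 1) p'' * c ⟨m, p, q⟩ ⟨m', p'', q'⟩ =
        ∑ p'', S.irrep m σ (Pi.single p'' 1) p * c ⟨m, p'', q⟩ ⟨m', p', q'⟩ := by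
    intro σ m m' p p' q q'
    have h₁ : Matrix.toEuclideanLin A (Matrix.toEuclideanLin (permOp σ) (S.basis ⟨m', p', q'⟩)) =
        Matrix.toEuclideanLin (permOp σ) (Matrix.toEuclideanLin A (S.basis ⟨m', p', q'⟩)) := by
      rw [← toEuclideanLin_mul, ← toEuclideanLin_mul, hA σ]
    have h₂ := congrArg (fun v => inner ℂ (S.basis ⟨m, p, q⟩) v) h₁
    rw [S.perm_apply, map_sum, inner_sum] at h₂
    simp_rw [map_smul, inner_smul_right] at h₂
    rw [h₂, ← S.basis.sum_repr (Matrix.toEuclideanLin A (S.basis ⟨m', p', q'⟩)), map_sum, inner_sum,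
      Fintype.sum_sigma, Finset.sum_eq_single m]
    · rw [Fintype.sum_prod_type]
      refine Finset.sum_congr rfl fun p₁ _ => ?_
      rw [Finset.sum_eq_single q]
      · rw [map_smul, S.perm_apply, inner_smul_right, inner_sum, Finset.sum_eq_single p]
        · simp [inner_smul_right, OrthonormalBasis.repr_apply_apply, mul_comm, hc]
        · intro b _ hb
          simp [inner_smul_right, S.inner_basis, Ne.symm hb]
        · simp
      · intro b _ hb
        rw [map_smul, S.perm_apply, inner_smul_right, inner_sum, Finset.sum_eq_zero, mul_zero]
        intro p₂ _
        simp [inner_smul_right, S.inner_basis, Ne.symm hb]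
      · simp
    · intro m₁ _ hm₁
      refine Finset.sum_eq_zero fun ⟨p₁, q₁⟩ _ => ?_
      rw [map_smul, S.perm_apply, inner_smul_right, inner_sum, Finset.sum_eq_zero, mul_zero]
      intro p₂ _
      simp [inner_smul_right, S.inner_basis, Ne.symm hm₁]
    · simp
  have hT : ∀ (m m' : Fin (n / 2 + 1)) (q : Fin (blockDim n m)) (q' : Fin (blockDim n m')),
      ∃ T : (S.irrep m').IntertwiningMap (S.irrep m),
        ∀ p p', T (Pi.single p' 1) p = c ⟨m, p, q⟩ ⟨m', p', q'⟩ := by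
    intro m m' q q'
    refine ⟨⟨Matrix.toLin' (Matrix.of fun p p' => c ⟨m, p, q⟩ ⟨m', p', q'⟩), ?_⟩, ?_⟩
    · intro σ
      refine LinearMap.pi_ext' fun p' => LinearMap.ext_ring ?_
      funext p
      have := hcomm σ m m' p p' q q'
      simp only [LinearMap.comp_apply, LinearMap.single_apply, Matrix.toLin'_apply, Matrix.mulVec,
        dotProduct, Matrix.of_apply]
      simp_rw [mul_comm (c _ _)]
      rw [this]
      have hv : (Matrix.of fun p p' => c ⟨m, p, q⟩ ⟨m', p', q'⟩).mulVec (Pi.single p' 1) =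
          ∑ p'', c ⟨m, p'', q⟩ ⟨m', p', q'⟩ • Pi.single p'' (1 : ℂ) := by
        funext p
        simp [Pi.single_apply, Finset.sum_apply]
      rw [hv, map_sum, Finset.sum_apply]
      simp_rw [map_smul, Pi.smul_apply, smul_eq_mul, mul_comm]
    · intro p p'
      change Matrix.toLin' (Matrix.of fun p p' => c ⟨m, p, q⟩ ⟨m', p', q'⟩) (Pi.single p' 1) p = _
      simp
  have hoff : ∀ (m m' : Fin (n / 2 + 1)) (p : Fin (multDim n m)) (p' : Fin (multDim n m'))
      (q : Fin (blockDim n m)) (q' : Fin (blockDim n m')), m ≠ m' →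
      c ⟨m, p, q⟩ ⟨m', p', q'⟩ = 0 := by
    intro m m' p p' q q' hm
    obtain ⟨T, hT⟩ := hT m m' q q'
    have := S.irreducible m
    have := S.irreducible m'
    have : IsEmpty ((S.irrep m').Equiv (S.irrep m)) :=
      ⟨fun e => hm (S.inequivalent m' m ⟨e⟩).symm⟩
    have h0 : T = 0 := Subsingleton.elim _ _
    rw [← hT, h0]
    rfl
  have hon : ∀ (m : Fin (n / 2 + 1)) (p p' : Fin (multDim n m)) (q q' : Fin (blockDim n m)),
      c ⟨m, p, q⟩ ⟨m, p', q'⟩ = if p = p' then block A m q q' else 0 := by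
    intro m p p' q q'
    obtain ⟨T, hT⟩ := hT m m q q'
    have := S.irreducible m
    obtain ⟨z, hz⟩ := (Representation.IsIrreducible.algebraMap_intertwiningMap_bijective_of_isAlgClosed
      (ρ := S.irrep m)).2 T
    have hTz : ∀ p p', T (Pi.single p' 1) p = if p = p' then z else 0 := by
      intro p p'
      rw [← hz]
      change (z • (Pi.single p' (1 : ℂ) : _ → ℂ)) p = _
      simp [Pi.single_apply]
    have hblock : block A m q q' = c ⟨m, S.p0 m, q⟩ ⟨m, S.p0 m, q'⟩ := by
      simp only [block, Matrix.of_apply, braket, ← S.canonical, hc]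
    rw [hblock, ← hT, ← hT, hTz, hTz, if_pos rfl]
  intro m p q'
  rw [← S.basis.sum_repr (Matrix.toEuclideanLin A (S.basis ⟨m, p, q'⟩)), Fintype.sum_sigma,
    Finset.sum_eq_single m, Fintype.sum_prod_type, Finset.sum_eq_single p]
  · refine Finset.sum_congr rfl fun q _ => ?_
    rw [OrthonormalBasis.repr_apply_apply]
    have := hon m p p q q'
    rw [if_pos rfl] at this
    rw [← this]
  · intro p₁ _ hp₁
    refine Finset.sum_eq_zero fun q _ => ?_
    rw [OrthonormalBasis.repr_apply_apply]
    have := hon m p₁ p q q'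
    rw [if_neg hp₁] at this
    change c _ _ • _ = _
    rw [this, zero_smul]
  · simp
  · intro m₁ _ hm₁
    refine Finset.sum_eq_zero fun ⟨p₁, q₁⟩ _ => ?_
    rw [OrthonormalBasis.repr_apply_apply]
    change c _ _ • _ = _
    rw [hoff _ _ _ _ _ _ hm₁, zero_smul]
  · simp

theorem HasBlocks.trace_mul {S : SchurBasis n} {W : Op n}
    {B : (m : Fin (n / 2 + 1)) → Matrix (Fin (blockDim n m)) (Fin (blockDim n m)) ℂ}
    (h : HasBlocks S W B) (ρ : Op n) :
    (ρ * W).trace = ∑ m, ∑ i, ∑ j, stateComponent S ρ m i j * B m j i := by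
  have h₁ : (ρ * W).trace = LinearMap.trace ℂ (Qubits n) (Matrix.toEuclideanLin (ρ * W)) := by
    rw [Matrix.toEuclideanLin_eq_toLin_orthonormal, Matrix.trace_toLin_eq]
  rw [h₁, LinearMap.trace_eq_sum_inner _ S.basis, Fintype.sum_sigma]
  refine Finset.sum_congr rfl fun m _ => ?_
  simp_rw [Fintype.sum_prod_type, toEuclideanLin_mul, h m, map_sum, map_smul, inner_sum,
    inner_smul_right]
  simp only [stateComponent, Matrix.of_apply, braket, Finset.sum_mul]
  have : ∀ (f : Fin (blockDim n m) → Fin (blockDim n m) → Fin (multDim n m) → ℂ),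
      ∑ p, ∑ q', ∑ q, f q' q p = ∑ q', ∑ q, ∑ p, f q' q p := by
    intro f
    rw [Finset.sum_comm]
    exact Finset.sum_congr rfl fun _ _ => Finset.sum_comm
  rw [this fun q' q p => B m q q' * inner ℂ (S.basis ⟨m, p, q'⟩)
    (Matrix.toEuclideanLin ρ (S.basis ⟨m, p, q⟩))]
  simp_rw [mul_comm]

/-- The block `U_λ` of the circuit, from the diagonalized blocks of the generators. -/
noncomputable def Diagonalization.layer {L : ℕ} {H : Fin L → Op n} (D : Diagonalization H)
    (l : Fin L) (m : Fin (n / 2 + 1)) : Matrix (Fin (blockDim n m)) (Fin (blockDim n m)) ℂ :=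
  D.Q l m * Matrix.diagonal (fun q => Complex.exp (-Complex.I * D.eig l m q)) *
    (D.Q l m).conjTranspose

theorem Diagonalization.hasBlocks_exp {L : ℕ} {H : Fin L → Op n} (D : Diagonalization H)
    (S : SchurBasis n) {l : Fin L} (hH : IsEquivariant (H l)) :
    HasBlocks S (NormedSpace.exp ((-Complex.I) • H l)) (D.layer l) := by
  refine HasBlocks.exp (lam := fun m q => -Complex.I * D.eig l m q) (D.unitary l) ?_
  have := (hH.hasBlocks S).smul (-Complex.I)
  convert this using 1
  funext m
  rw [D.block_eq, ← smul_mul_assoc, ← mul_smul_comm, ← Matrix.diagonal_smul]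
  rfl

theorem expectation_circuit {L : ℕ} {H : Fin L → Op n} (hH : ∀ l, IsEquivariant (H l))
    (S : SchurBasis n) (D : Diagonalization H) (ρ O : Op n)
    {B : (m : Fin (n / 2 + 1)) → Matrix (Fin (blockDim n m)) (Fin (blockDim n m)) ℂ}
    (hO : HasBlocks S O B) :
    expectation (circuit H) ρ O = ∑ m, ∑ i, ∑ j, stateComponent S ρ m i j *
      (((List.ofFn fun l => D.layer l m).prod).conjTranspose *
        (B m * (List.ofFn fun l => D.layer l m).prod)) j i := by
  have hU : HasBlocks S (circuit H) _ := HasBlocks.listProd fun l => D.hasBlocks_exp S (hH l)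
  rw [← (hU.conjTranspose.mul (hO.mul hU)).trace_mul ρ, expectation]
  rw [Matrix.mul_assoc, Matrix.mul_assoc, Matrix.trace_mul_comm]
  simp only [Matrix.mul_assoc]

/-! ## The blocks of the observables -/

theorem HasBlocks.of_canonicalVec {A : Op n} (hA : IsEquivariant A) (S : SchurBasis n)
    {B : (m : Fin (n / 2 + 1)) → Matrix (Fin (blockDim n m)) (Fin (blockDim n m)) ℂ}
    (h : ∀ (m : Fin (n / 2 + 1)) (q' : Fin (blockDim n m)),
      Matrix.toEuclideanLin A (canonicalVec n m q') = ∑ q, B m q q' • canonicalVec n m (q : ℕ)) :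
    HasBlocks S A B := by
  have hB : block A = B := by
    funext m
    ext q q'
    rw [block, Matrix.of_apply, braket, h, inner_sum]
    simp_rw [← S.canonical]
    simp [inner_smul_right, S.inner_basis]
  exact hB ▸ hA.hasBlocks S

theorem isEquivariant_of_comp {A : Op n}
    (h : ∀ (σ : Equiv.Perm (Fin n)) (y x : Bits n), A (y ∘ σ) (x ∘ σ) = A y x) :
    IsEquivariant A := by
  intro σ
  ext y x
  have h₁ : (permOp σ * A) y x = A (y ∘ σ) x := by
    rw [Matrix.mul_apply, Finset.sum_eq_single (y ∘ σ)]
    · simp [permOp]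
    · intro z _ hz
      have : y ≠ fun i => z (σ.symm i) := by rintro rfl; apply hz; funext i; simp
      simp [permOp, this]
    · simp
  have h₂ : (A * permOp σ) y x = A y (x ∘ σ.symm) := by
    rw [Matrix.mul_apply, Finset.sum_eq_single (x ∘ σ.symm)]
    · simp [permOp, Function.comp_def]
    · intro z _ hz
      have : ¬ z = fun i => x (σ.symm i) := hz
      simp [permOp, this]
    · simp
  rw [h₁, h₂, ← h σ y]
  congr 1
  funext i
  simp

theorem tensorOp_mul (M M' : Fin n → Matrix (Fin 2) (Fin 2) ℂ) :
    tensorOp M * tensorOp M' = tensorOp fun j => M j * M' j := by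
  ext y x
  simp only [tensorOp, Matrix.mul_apply, Matrix.of_apply, ← Finset.prod_mul_distrib]
  rw [Finset.prod_univ_sum, Fintype.piFinset_univ]

theorem tensorOp_one : tensorOp (fun _ : Fin n => 1) = 1 := by
  ext y x
  simp only [tensorOp, Matrix.of_apply, Matrix.one_apply]
  split_ifs with h
  · simp [h]
  · obtain ⟨j, hj⟩ := Function.ne_iff.1 h
    exact Finset.prod_eq_zero (Finset.mem_univ j) (by simp [hj])

theorem Pauli.matrix_mul_self (P : Pauli) : P.matrix * P.matrix = 1 := by
  cases P <;> ext i j <;> fin_cases i <;> fin_cases j <;> simp [Pauli.matrix]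

theorem Pauli.onQubit_mul_self (P : Pauli) (j : Fin n) : P.onQubit j * P.onQubit j = 1 := by
  rw [Pauli.onQubit, tensorOp_mul, ← tensorOp_one]
  congr 1
  funext k
  by_cases hk : k = j
  · subst hk; simp [P.matrix_mul_self]
  · simp [hk]

theorem Pauli.onQubit_commute (P : Pauli) (j k : Fin n) :
    P.onQubit j * P.onQubit k = P.onQubit k * P.onQubit j := by
  rw [Pauli.onQubit, Pauli.onQubit, tensorOp_mul, tensorOp_mul]
  congr 1
  funext i
  by_cases hj : i = j <;> by_cases hk : i = k <;> simp [Function.update_apply, hj, hk]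

/-- The collective operator `∑_j P_j`. -/
noncomputable def Pauli.collective (n : ℕ) (P : Pauli) : Op n := ∑ j : Fin n, P.onQubit j

theorem Pauli.sum_onQubit_mul (P : Pauli) :
    (2 : ℂ) • ∑ j : Fin n, ∑ k ∈ Finset.Iio j, P.onQubit j * P.onQubit k =
      P.collective n * P.collective n - (n : ℂ) • 1 := by
  set f : Fin n → Fin n → Op n := fun j k => P.onQubit j * P.onQubit k with hf
  have h₁ : P.collective n * P.collective n = ∑ j, ∑ k, f j k := by
    simp only [Pauli.collective, Finset.sum_mul, Finset.mul_sum, hf]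
    rw [Finset.sum_comm]
  have h₂ : ∀ j, ∑ k, f j k = ∑ k ∈ Finset.Iio j, f j k + 1 + ∑ k ∈ Finset.Ioi j, f j k := by
    intro j
    have hu : (Finset.univ : Finset (Fin n)) =
        (Finset.Iio j).disjUnion ({j} ∪ Finset.Ioi j) (by
          rw [Finset.disjoint_left]; intro a; simp +contextual) := by
      ext a
      simp only [Finset.mem_univ, Finset.mem_disjUnion, Finset.mem_union, Finset.mem_Iio,
        Finset.mem_singleton, Finset.mem_Ioi, true_iff]
      exact lt_trichotomy a j
    rw [hu, Finset.sum_disjUnion, Finset.sum_union (by simp), Finset.sum_singleton, add_assoc]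
    simp [hf, P.onQubit_mul_self]
  have h₃ : ∑ j, ∑ k ∈ Finset.Ioi j, f j k = ∑ j, ∑ k ∈ Finset.Iio j, f j k := by
    rw [Finset.sum_comm' (t' := Finset.univ) (s' := fun k => Finset.Iio k) (by simp)]
    exact Finset.sum_congr rfl fun j _ => Finset.sum_congr rfl fun k _ => P.onQubit_commute _ _
  rw [h₁]
  simp_rw [h₂, Finset.sum_add_distrib]
  rw [h₃, two_smul]
  simp only [Finset.sum_const, Finset.card_univ, Fintype.card_fin, Nat.cast_smul_eq_nsmul]
  abel

theorem Pauli.collective_isEquivariant (P : Pauli) : IsEquivariant (P.collective n) := by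
  refine isEquivariant_of_comp fun σ y x => ?_
  simp only [Pauli.collective, Matrix.sum_apply]
  rw [← Equiv.sum_comp σ (fun j => P.onQubit j y x)]
  refine Finset.sum_congr rfl fun j _ => ?_
  simp only [Pauli.onQubit, tensorOp, Matrix.of_apply]
  rw [← Equiv.prod_comp σ (fun k => Function.update (fun _ => (1 : Matrix (Fin 2) (Fin 2) ℂ)) (σ j) P.matrix k
    (y k) (x k))]
  refine Finset.prod_congr rfl fun k _ => ?_
  simp [Function.update_apply]

theorem tensorOp_const_isEquivariant (M : Matrix (Fin 2) (Fin 2) ℂ) :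
    IsEquivariant (tensorOp fun _ : Fin n => M) := by
  refine isEquivariant_of_comp fun σ y x => ?_
  simp only [tensorOp, Matrix.of_apply]
  exact Equiv.prod_comp σ (fun k => M (y k) (x k))

theorem Pauli.collective_apply (P : Pauli) (v : Qubits n) (x : Bits n) :
    Matrix.toEuclideanLin (P.collective n) v x =
      ∑ j, ∑ b, P.matrix (x j) b * v (Function.update x j b) := by
  have key : ∀ j, ∑ y, P.onQubit j x y * v y =
      ∑ b, P.matrix (x j) b * v (Function.update x j b) := by
    intro j
    symm
    refine Finset.sum_of_injOn (fun b => Function.update x j b)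
      (fun b _ b' _ h => by simpa using congrFun h j) (fun _ _ => Finset.mem_coe.2 (Finset.mem_univ _))
      ?_ ?_
    · intro y _ hy
      have : ∃ k ≠ j, y k ≠ x k := by
        by_contra! hk
        refine hy ⟨y j, by simp, ?_⟩
        funext k
        by_cases hkj : k = j
        · subst hkj; simp
        · simp [hkj, hk k hkj]
      obtain ⟨k, hkj, hk⟩ := this
      rw [Pauli.onQubit, tensorOp, Matrix.of_apply,
        Finset.prod_eq_zero (Finset.mem_univ k) (by simp [hkj, Matrix.one_apply_ne hk.symm]),
        zero_mul]
    · intro b _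
      congr 1
      rw [Pauli.onQubit, tensorOp, Matrix.of_apply, Finset.prod_eq_single j]
      · simp
      · intro k _ hk; simp [hk]
      · simp
  rw [Matrix.toLpLin_apply]
  simp only [Matrix.mulVec, dotProduct, Pauli.collective, Matrix.sum_apply, Finset.sum_mul]
  rw [Finset.sum_comm]
  exact Finset.sum_congr rfl fun j _ => key j

@[to_additive]
theorem prod_eq_pairs_mul {M : Type*} [CommMonoid M] (f : Fin n → M) {m : ℕ} (hm : 2 * m ≤ n) :
    ∏ j, f j = (∏ k : Fin m, f ⟨2 * (k : ℕ), by omega⟩ * f ⟨2 * (k : ℕ) + 1, by omega⟩) *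
      ∏ j ∈ Finset.univ.filter (fun j : Fin n => 2 * m ≤ (j : ℕ)), f j := by
  induction m with
  | zero => simp
  | succ m ih =>
    rw [ih (by omega), Fin.prod_univ_castSucc, mul_assoc]
    congr 1
    have : (Finset.univ.filter fun j : Fin n => 2 * m ≤ (j : ℕ)) =
        insert ⟨2 * m, by omega⟩ (insert ⟨2 * m + 1, by omega⟩
          (Finset.univ.filter fun j : Fin n => 2 * (m + 1) ≤ (j : ℕ))) := by
      ext j
      simp only [Finset.mem_filter, Finset.mem_univ, true_and, Finset.mem_insert, Fin.ext_iff]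
      omega
    rw [this, Finset.prod_insert (by simp), Finset.prod_insert (by simp; omega), mul_assoc]
    rfl

/-- The Hamming weight on the qubits that carry the Dicke state. -/
def tailWeight (m : ℕ) (x : Bits n) : ℕ :=
  (Finset.univ.filter fun j : Fin n => 2 * m ≤ (j : ℕ) ∧ x j = 1).card

/-- The amplitude of the singlets. -/
noncomputable def singlets (m : Fin (n / 2 + 1)) (x : Bits n) : ℂ :=
  ∏ k : Fin (m : ℕ), singlet (x ⟨2 * (k : ℕ), by omega⟩) (x ⟨2 * (k : ℕ) + 1, by omega⟩)

/-- Amplitudes of the Dicke state of weight `q` on `N` qubits. -/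
noncomputable def dicke (N q w : ℕ) : ℂ := if w = q then 1 / (Real.sqrt (N.choose q : ℝ) : ℂ) else 0

theorem canonicalVec_apply (m : Fin (n / 2 + 1)) (q : ℕ) (x : Bits n) :
    canonicalVec n m q x = singlets m x * dicke (n - 2 * m) q (tailWeight m x) := rfl

theorem card_tail (m : ℕ) :
    (Finset.univ.filter fun j : Fin n => 2 * m ≤ (j : ℕ)).card = n - 2 * m := by
  rcases le_or_gt (2 * m) n with h | h
  · have h₁ := sum_eq_pairs_add (fun _ : Fin n => 1) h
    simp at h₁
    omega
  · rw [Finset.card_eq_zero.2, Nat.sub_eq_zero_of_le h.le]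
    exact Finset.filter_eq_empty_iff.2 fun j _ => by omega

theorem card_tail_one (m : ℕ) (x : Bits n) :
    ((Finset.univ.filter fun j : Fin n => 2 * m ≤ (j : ℕ)).filter fun j => x j = 1).card =
      tailWeight m x := by
  rw [Finset.filter_filter, tailWeight]

theorem card_tail_zero (m : ℕ) (x : Bits n) :
    ((Finset.univ.filter fun j : Fin n => 2 * m ≤ (j : ℕ)).filter fun j => ¬ x j = 1).card =
      n - 2 * m - tailWeight m x := by
  have h := Finset.card_filter_add_card_filter_not
    (s := Finset.univ.filter fun j : Fin n => 2 * m ≤ (j : ℕ)) (fun j => x j = 1)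
  rw [card_tail, card_tail_one] at h
  omega

theorem tailWeight_le (m : ℕ) (x : Bits n) : tailWeight m x ≤ n - 2 * m := by
  rw [← card_tail m, ← card_tail_one]
  exact Finset.card_filter_le _ _

@[to_additive]
theorem prod_tail {M : Type*} [CommMonoid M] (f : Fin 2 → M) (m : ℕ) (x : Bits n) :
    ∏ j ∈ Finset.univ.filter (fun j : Fin n => 2 * m ≤ (j : ℕ)), f (x j) =
      f 0 ^ (n - 2 * m - tailWeight m x) * f 1 ^ tailWeight m x := by
  rw [← Finset.prod_filter_not_mul_prod_filter _ (fun j => x j = 1), ← card_tail_zero,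
    ← card_tail_one]
  congr 1
  · refine Finset.prod_eq_pow_card fun j hj => ?_
    rw [Finset.mem_filter] at hj
    rw [show x j = 0 by omega]
  · refine Finset.prod_eq_pow_card fun j hj => ?_
    rw [Finset.mem_filter] at hj
    rw [hj.2]

theorem tailWeight_update_of_lt {m : ℕ} {j : Fin n} (hj : (j : ℕ) < 2 * m) (x : Bits n)
    (b : Fin 2) : tailWeight m (Function.update x j b) = tailWeight m x := by
  rw [tailWeight, tailWeight]
  congr 1
  refine Finset.filter_congr fun k _ => and_congr_right fun hk => ?_
  rw [Function.update_of_ne]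
  rintro rfl
  omega

theorem tailWeight_update {m : ℕ} {j : Fin n} (hj : 2 * m ≤ (j : ℕ)) (x : Bits n) (b : Fin 2) :
    tailWeight m (Function.update x j b) + (x j : ℕ) = tailWeight m x + b := by
  have h : ∀ y : Bits n, tailWeight m y =
      (y j : ℕ) + ∑ k ∈ (Finset.univ.filter fun k : Fin n => 2 * m ≤ (k : ℕ)).erase j, (y k : ℕ) := by
    intro y
    rw [Finset.add_sum_erase _ (fun k => (y k : ℕ)) (by simpa using hj),
      sum_tail (fun b : Fin 2 => (b : ℕ))]
    simp
  rw [h x, h (Function.update x j b)]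
  have : ∑ k ∈ (Finset.univ.filter fun k : Fin n => 2 * m ≤ (k : ℕ)).erase j,
      (Function.update x j b k : ℕ) =
      ∑ k ∈ (Finset.univ.filter fun k : Fin n => 2 * m ≤ (k : ℕ)).erase j, (x k : ℕ) :=
    Finset.sum_congr rfl fun k hk => by rw [Function.update_of_ne (Finset.ne_of_mem_erase hk)]
  rw [this, Function.update_self]
  omega

theorem singlets_update_of_le {m : Fin (n / 2 + 1)} {j : Fin n} (hj : 2 * (m : ℕ) ≤ (j : ℕ))
    (x : Bits n) (b : Fin 2) : singlets m (Function.update x j b) = singlets m x := by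
  refine Finset.prod_congr rfl fun k _ => ?_
  rw [Function.update_of_ne, Function.update_of_ne]
  all_goals
    rintro rfl
    simp only at hj
    omega

/-- Entries of the blocks of collective operators. -/
noncomputable def collectiveEntry (M : Matrix (Fin 2) (Fin 2) ℂ) (N q q' : ℕ) : ℂ :=
  (if q = q' then M 0 0 * (N - q : ℕ) + M 1 1 * q else 0) +
  (if q = q' + 1 then M 1 0 * (Real.sqrt ((q * (N - q') : ℕ) : ℝ) : ℂ) else 0) +
  (if q' = q + 1 then M 0 1 * (Real.sqrt ((q' * (N - q) : ℕ) : ℝ) : ℂ) else 0)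

theorem sqrt_choose_succ {N q : ℕ} (hq : q < N) :
    ((q + 1 : ℕ) : ℝ) / Real.sqrt (N.choose q) =
      Real.sqrt (((q + 1) * (N - q) : ℕ) : ℝ) / Real.sqrt (N.choose (q + 1)) ∧
    ((N - q : ℕ) : ℝ) / Real.sqrt (N.choose (q + 1)) =
      Real.sqrt (((q + 1) * (N - q) : ℕ) : ℝ) / Real.sqrt (N.choose q) := by
  have h : ((N.choose (q + 1) : ℕ) : ℝ) * ((q + 1 : ℕ) : ℝ) = N.choose q * ((N - q : ℕ) : ℝ) := by
    exact_mod_cast Nat.choose_succ_right_eq N q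
  have h₁ : (0 : ℝ) < N.choose q := by exact_mod_cast Nat.choose_pos hq.le
  have h₂ : (0 : ℝ) < N.choose (q + 1) := by exact_mod_cast Nat.choose_pos hq
  have ha : (0 : ℝ) < ((q + 1 : ℕ) : ℝ) := by positivity
  have hb : (0 : ℝ) < ((N - q : ℕ) : ℝ) := by exact_mod_cast Nat.sub_pos_of_lt hq
  push_cast only [Nat.cast_mul]
  generalize ((q + 1 : ℕ) : ℝ) = a at *
  generalize ((N - q : ℕ) : ℝ) = b at *
  generalize ((N.choose q : ℕ) : ℝ) = u at *
  generalize ((N.choose (q + 1) : ℕ) : ℝ) = v at *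
  rw [div_eq_div_iff (Real.sqrt_pos.2 h₁).ne' (Real.sqrt_pos.2 h₂).ne',
    div_eq_div_iff (Real.sqrt_pos.2 h₂).ne' (Real.sqrt_pos.2 h₁).ne']
  constructor
  · rw [← Real.sqrt_mul (by positivity), ← Real.sqrt_sq ha.le, ← Real.sqrt_mul (by positivity),
      Real.sqrt_sq ha.le]
    congr 1
    linear_combination a * h
  · rw [← Real.sqrt_mul (by positivity), ← Real.sqrt_sq hb.le, ← Real.sqrt_mul (by positivity),
      Real.sqrt_sq hb.le]
    congr 1
    linear_combination -b * h

theorem collectiveEntry_div_sqrt (M : Matrix (Fin 2) (Fin 2) ℂ) {N w q : ℕ} (hw : w ≤ N)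
    (hq : q ≤ N) :
    (N - w : ℕ) * (M 0 0 * dicke N q w + M 0 1 * dicke N q (w + 1)) +
        w * (M 1 0 * dicke N q (w - 1) + M 1 1 * dicke N q w) =
      collectiveEntry M N w q / (Real.sqrt (N.choose w : ℝ) : ℂ) := by
  have hw1 : (w : ℂ) * dicke N q (w - 1) =
      if w = q + 1 then w * (1 / (Real.sqrt (N.choose q : ℝ) : ℂ)) else 0 := by
    rcases w with _ | w
    · simp
    · simp [dicke]
  have e : (N - w : ℕ) * (M 0 0 * dicke N q w + M 0 1 * dicke N q (w + 1)) +
        w * (M 1 0 * dicke N q (w - 1) + M 1 1 * dicke N q w) =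
      ((N - w : ℕ) * M 0 0 + w * M 1 1) * dicke N q w + M 1 0 * (w * dicke N q (w - 1)) +
        M 0 1 * ((N - w : ℕ) * dicke N q (w + 1)) := by ring
  rw [e, hw1, collectiveEntry]
  by_cases h₁ : w = q
  · subst h₁
    simp [dicke]
    ring
  by_cases h₂ : w = q + 1
  · subst h₂
    have := congrArg (fun r : ℝ => (r : ℂ)) (sqrt_choose_succ (N := N) (q := q) (by omega)).1
    push_cast only [Complex.ofReal_div, Complex.ofReal_natCast] at this
    simp only [dicke, if_neg h₁, if_pos, if_neg (show ¬ q + 1 + 1 = q by omega),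
      if_neg (show ¬ q = q + 1 + 1 by omega), mul_zero, zero_add, add_zero, mul_div_assoc, ← this]
    ring
  by_cases h₃ : q = w + 1
  · subst h₃
    have := congrArg (fun r : ℝ => (r : ℂ)) (sqrt_choose_succ (N := N) (q := w) (by omega)).2
    push_cast only [Complex.ofReal_div, Complex.ofReal_natCast] at this
    simp only [dicke, if_neg h₁, if_pos, if_neg h₂, mul_zero, zero_add, add_zero, mul_div_assoc,
      ← this]
    ring
  · simp [dicke, h₁, h₂, h₃, Ne.symm h₃]

theorem Pauli.matrix_trace (P : Pauli) : P.matrix 0 0 + P.matrix 1 1 = 0 := by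
  cases P <;> simp [Pauli.matrix]

/-- The singlet is annihilated by `M ⊗ 1 + 1 ⊗ M` if `M` has trace zero. -/
theorem sum_mul_singlet {M : Matrix (Fin 2) (Fin 2) ℂ} (hM : M 0 0 + M 1 1 = 0) (a c : Fin 2) :
    ∑ b, M a b * singlet b c + ∑ b, M c b * singlet a b = 0 := by
  fin_cases a <;> fin_cases c <;> simp [singlet]
  · linear_combination (1 / (Real.sqrt 2 : ℂ)) * hM
  · linear_combination -(1 / (Real.sqrt 2 : ℂ)) * hM

theorem sum_smul_canonicalVec (m : Fin (n / 2 + 1)) (g : Fin (blockDim n m) → ℂ) (x : Bits n)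
    (w : Fin (blockDim n m)) (hw : tailWeight m x = w) :
    (∑ q, g q • canonicalVec n m (q : ℕ)) x =
      singlets m x * (g w / (Real.sqrt ((n - 2 * (m : ℕ)).choose w : ℝ) : ℂ)) := by
  rw [WithLp.ofLp_sum, Finset.sum_apply, Finset.sum_eq_single w]
  · simp only [PiLp.smul_apply, smul_eq_mul, canonicalVec_apply, hw, dicke, if_true]
    ring
  · intro q _ hq
    have : ¬ (w : ℕ) = q := fun h => hq (Fin.ext h.symm)
    simp [canonicalVec_apply, hw, dicke, this]
  · simp

theorem Pauli.collective_canonicalVec (P : Pauli) (m : Fin (n / 2 + 1))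
    (q' : Fin (blockDim n m)) :
    Matrix.toEuclideanLin (P.collective n) (canonicalVec n m q') =
      ∑ q : Fin (blockDim n m),
        collectiveEntry P.matrix (n - 2 * m) q q' • canonicalVec n m (q : ℕ) := by
  have hm : 2 * (m : ℕ) ≤ n := by omega
  ext x
  have hwN := tailWeight_le m x
  have hq' : (q' : ℕ) ≤ n - 2 * m := by have := q'.2; simp only [blockDim] at this; omega
  rw [sum_smul_canonicalVec m _ x ⟨tailWeight m x, by simp only [blockDim]; omega⟩ rfl,
    ← collectiveEntry_div_sqrt _ hwN hq', P.collective_apply, sum_eq_pairs_add _ hm,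
    Finset.sum_eq_zero, zero_add]
  · set τ : Fin 2 → ℂ := fun a => singlets m x * ∑ b : Fin 2, P.matrix a b *
      dicke (n - 2 * m) q' (tailWeight m x + b - a) with hτ
    have hsum : ∀ j ∈ (Finset.univ.filter fun j : Fin n => 2 * (m : ℕ) ≤ (j : ℕ)),
        ∑ b, P.matrix (x j) b * canonicalVec n m q' (Function.update x j b) = τ (x j) := by
      intro j hj
      have hj' : 2 * (m : ℕ) ≤ (j : ℕ) := by simpa using hj
      simp only [hτ, Finset.mul_sum]
      refine Finset.sum_congr rfl fun b _ => ?_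
      rw [canonicalVec_apply, singlets_update_of_le hj',
        show tailWeight m (Function.update x j b) = tailWeight m x + b - (x j : ℕ) by
          have := tailWeight_update hj' x b; omega]
      ring
    rw [Finset.sum_congr rfl hsum, sum_tail]
    simp only [hτ, Fin.sum_univ_two, nsmul_eq_mul, Fin.val_zero, Fin.val_one, add_zero,
      Nat.sub_zero, Nat.add_sub_cancel]
    ring
  · intro k _
    set R : ℂ := ∏ k' ∈ Finset.univ.erase k,
      singlet (x ⟨2 * (k' : ℕ), by omega⟩) (x ⟨2 * (k' : ℕ) + 1, by omega⟩) with hR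
    have key : ∀ y : Bits n, (∀ j : Fin n, (j : ℕ) ≠ 2 * k → (j : ℕ) ≠ 2 * k + 1 → y j = x j) →
        singlets m y = singlet (y ⟨2 * (k : ℕ), by omega⟩) (y ⟨2 * (k : ℕ) + 1, by omega⟩) * R := by
      intro y hy
      rw [singlets, ← Finset.mul_prod_erase _ _ (Finset.mem_univ k), hR]
      congr 1
      refine Finset.prod_congr rfl fun k' hk' => ?_
      have : (k' : ℕ) ≠ k := fun h => Finset.ne_of_mem_erase hk' (Fin.ext h)
      rw [hy _ (by simp only; omega) (by simp only; omega),
        hy _ (by simp only; omega) (by simp only; omega)]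
    have h₀ : ∀ b, canonicalVec n m q' (Function.update x ⟨2 * (k : ℕ), by omega⟩ b) =
        singlet b (x ⟨2 * (k : ℕ) + 1, by omega⟩) * (R * dicke (n - 2 * m) q' (tailWeight m x)) := by
      intro b
      rw [canonicalVec_apply, key, tailWeight_update_of_lt (by simp only; omega),
        Function.update_self, Function.update_of_ne (by simp), mul_assoc]
      intro j hj _
      exact Function.update_of_ne (fun h => hj (congrArg Fin.val h)) _ _
    have h₁ : ∀ b, canonicalVec n m q' (Function.update x ⟨2 * (k : ℕ) + 1, by omega⟩ b) =
        singlet (x ⟨2 * (k : ℕ), by omega⟩) b * (R * dicke (n - 2 * m) q' (tailWeight m x)) := by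
      intro b
      rw [canonicalVec_apply, key, tailWeight_update_of_lt (by simp only; omega),
        Function.update_self, Function.update_of_ne (by simp), mul_assoc]
      intro j _ hj
      exact Function.update_of_ne (fun h => hj (congrArg Fin.val h)) _ _
    simp_rw [h₀, h₁, ← mul_assoc, ← Finset.sum_mul]
    rw [← add_mul, ← add_mul, sum_mul_singlet P.matrix_trace, zero_mul, zero_mul]

/-- The shift of the computational basis by a Pauli matrix. -/
def Pauli.flip : Pauli → Fin 2
  | .X => 1
  | .Y => 1
  | .Z => 0

theorem Pauli.matrix_eq_zero (P : Pauli) {a b : Fin 2} (h : b ≠ a + P.flip) :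
    P.matrix a b = 0 := by
  cases P <;> fin_cases a <;> fin_cases b <;> simp_all [Pauli.matrix, Pauli.flip]

theorem Pauli.mul_singlet (P : Pauli) (a c : Fin 2) :
    P.matrix a (a + P.flip) * P.matrix c (c + P.flip) * singlet (a + P.flip) (c + P.flip) =
      -1 * singlet a c := by
  cases P <;> fin_cases a <;> fin_cases c <;> simp [Pauli.matrix, Pauli.flip, singlet]

theorem Pauli.tensorOp_apply (P : Pauli) (v : Qubits n) (x : Bits n) :
    Matrix.toEuclideanLin (tensorOp fun _ => P.matrix) v x =
      (∏ j, P.matrix (x j) (x j + P.flip)) * v (fun j => x j + P.flip) := by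
  rw [Matrix.toLpLin_apply]
  simp only [Matrix.mulVec, dotProduct]
  rw [Finset.sum_eq_single fun j => x j + P.flip]
  · rfl
  · intro y _ hy
    obtain ⟨j, hj⟩ := Function.ne_iff.1 hy
    rw [tensorOp, Matrix.of_apply, Finset.prod_eq_zero (Finset.mem_univ j) (P.matrix_eq_zero hj),
      zero_mul]
  · simp

/-- Weights that a Pauli string maps to each other. -/
def Pauli.reflect (P : Pauli) (N w : ℕ) : ℕ := (1 - (P.flip : ℕ)) * w + P.flip * (N - w)

theorem tailWeight_add_flip (P : Pauli) (m : ℕ) (x : Bits n) :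
    tailWeight m (fun j => x j + P.flip) = P.reflect (n - 2 * m) (tailWeight m x) := by
  have hx : tailWeight m (fun j => x j + 1) = n - 2 * m - tailWeight m x := by
    rw [← card_tail_zero, ← card_tail_one]
    congr 1
    exact Finset.filter_congr fun j _ => by omega
  cases P
  · simpa [Pauli.reflect, Pauli.flip] using hx
  · simpa [Pauli.reflect, Pauli.flip] using hx
  · simp [Pauli.reflect, Pauli.flip]

/-- Entries of the blocks of the operators `⨂_j P_j`. -/
noncomputable def Pauli.globalEntry (P : Pauli) (m N q q' : ℕ) : ℂ :=
  (-1) ^ m * P.matrix 0 P.flip ^ (N - q) * P.matrix 1 (1 + P.flip) ^ q *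
    if P.reflect N q = q' then 1 else 0

theorem Pauli.global_canonicalVec (P : Pauli) (m : Fin (n / 2 + 1)) (q' : Fin (blockDim n m)) :
    Matrix.toEuclideanLin (tensorOp fun _ => P.matrix) (canonicalVec n m q') =
      ∑ q : Fin (blockDim n m), P.globalEntry m (n - 2 * m) q q' • canonicalVec n m (q : ℕ) := by
  have hm : 2 * (m : ℕ) ≤ n := by omega
  ext x
  have hwN := tailWeight_le m x
  rw [sum_smul_canonicalVec m _ x ⟨tailWeight m x, by simp only [blockDim]; omega⟩ rfl,
    P.tensorOp_apply, prod_eq_pairs_mul _ hm, prod_tail (fun a => P.matrix a (a + P.flip)),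
    canonicalVec_apply, tailWeight_add_flip]
  have hs : (∏ k : Fin (m : ℕ), P.matrix (x ⟨2 * (k : ℕ), by omega⟩)
        (x ⟨2 * (k : ℕ), by omega⟩ + P.flip) * P.matrix (x ⟨2 * (k : ℕ) + 1, by omega⟩)
        (x ⟨2 * (k : ℕ) + 1, by omega⟩ + P.flip)) * singlets m (fun j => x j + P.flip) =
      (-1) ^ (m : ℕ) * singlets m x := by
    rw [singlets, singlets, ← Finset.prod_mul_distrib]
    simp_rw [P.mul_singlet]
    rw [Finset.prod_mul_distrib]
    simp
  have hd : dicke (n - 2 * m) q' (P.reflect (n - 2 * m) (tailWeight m x)) =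
      (if P.reflect (n - 2 * m) (tailWeight m x) = q' then 1 else 0) /
        (Real.sqrt ((n - 2 * (m : ℕ)).choose (tailWeight m x) : ℝ) : ℂ) := by
    rw [dicke]
    split_ifs with h
    · rw [← h, show (n - 2 * (m : ℕ)).choose (P.reflect (n - 2 * m) (tailWeight m x)) =
        (n - 2 * (m : ℕ)).choose (tailWeight m x) by
          cases P <;> simp [Pauli.reflect, Pauli.flip, Nat.choose_symm hwN]]
    · simp
  rw [hd, Pauli.globalEntry, zero_add]
  linear_combination (P.matrix 0 P.flip ^ (n - 2 * m - tailWeight m x) *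
    P.matrix 1 (1 + P.flip) ^ tailWeight m x *
    ((if P.reflect (n - 2 * m) (tailWeight m x) = q' then 1 else 0) /
        (Real.sqrt ((n - 2 * (m : ℕ)).choose (tailWeight m x) : ℝ) : ℂ))) * hs

/-- The blocks of collective operators. -/
noncomputable def Pauli.collectiveBlock (P : Pauli) (n m : ℕ) :
    Matrix (Fin (blockDim n m)) (Fin (blockDim n m)) ℂ :=
  Matrix.of fun q q' => collectiveEntry P.matrix (n - 2 * m) q q'

/-- The blocks of the observables. -/
noncomputable def Obs.blocks (n m : ℕ) : Obs → Matrix (Fin (blockDim n m)) (Fin (blockDim n m)) ℂ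
  | .oneLocal P => (1 / (n : ℂ)) • P.collectiveBlock n m
  | .twoLocal P => (1 / ((n : ℂ) * ((n : ℂ) - 1))) •
      (P.collectiveBlock n m * P.collectiveBlock n m + (-(n : ℂ)) • 1)
  | .global P => Matrix.of fun q q' => P.globalEntry m (n - 2 * m) q q'

theorem Obs.hasBlocks (O : Obs) (S : SchurBasis n) :
    HasBlocks S (O.op n) fun m => O.blocks n m := by
  have hJ : ∀ P : Pauli, HasBlocks S (P.collective n) fun m => P.collectiveBlock n m := fun P =>
    .of_canonicalVec P.collective_isEquivariant S fun m q' => P.collective_canonicalVec m q'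
  cases O with
  | oneLocal P => exact (hJ P).smul _
  | twoLocal P =>
    have h := (((hJ P).mul (hJ P)).add (HasBlocks.one.smul (-(n : ℂ)))).smul
      (1 / ((n : ℂ) * ((n : ℂ) - 1)))
    rw [neg_smul, ← sub_eq_add_neg, ← P.sum_onQubit_mul, smul_smul, one_div_mul_eq_div] at h
    exact h
  | global P =>
    exact .of_canonicalVec (tensorOp_const_isEquivariant _) S fun m q' => P.global_canonicalVec m q'

/-! ## The program -/

theorem halts_ite {a b : NExp} {c d : Cmd} {s : State} {T : ℕ} {Q : State → Prop}
    (hc : a.eval s < b.eval s → Halts c s T Q) (hd : ¬ a.eval s < b.eval s → Halts d s T Q) :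
    Halts (.ite a b c d) s (a.cost + b.cost + 1 + T) Q := by
  by_cases h : a.eval s < b.eval s
  · obtain ⟨t, s', hr, ht, _, hq⟩ := hc h
    exact ⟨_, s', .iteTrue h hr, by omega, (Run.iteTrue h hr).agree, hq⟩
  · obtain ⟨t, s', hr, ht, _, hq⟩ := hd h
    exact ⟨_, s', .iteFalse h hr, by omega, (Run.iteFalse h hr).agree, hq⟩

theorem halts_skip {s : State} {Q : State → Prop} (h : Q s) : Halts .skip s 1 Q :=
  ⟨1, s, .skip s, le_rfl, Agree.refl _ _, h⟩

/-- The indicator of the equality of two numbers. -/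
def NExp.eq (a b : NExp) : NExp := .sub (.const 1) (.add (.sub a b) (.sub b a))

theorem NExp.eval_eq (s : State) (a b : NExp) :
    (NExp.eq a b).eval s = if a.eval s = b.eval s then 1 else 0 := by
  simp only [NExp.eq, NExp.eval]
  split_ifs <;> omega

/-- The entries of the Pauli matrix with the code in register 3. -/
def CExp.pauli : Fin 2 → Fin 2 → CExp
  | 0, 0 => .ofNat (.eq (.reg 3) (.const 2))
  | 0, 1 => .sub (.ofNat (.eq (.reg 3) (.const 0))) (.mul .imag (.ofNat (.eq (.reg 3) (.const 1))))
  | 1, 0 => .add (.ofNat (.eq (.reg 3) (.const 0))) (.mul .imag (.ofNat (.eq (.reg 3) (.const 1))))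
  | 1, 1 => .sub (.ofNat (.const 0)) (.ofNat (.eq (.reg 3) (.const 2)))

theorem CExp.eval_pauli {s : State} {P : Pauli} (h : s.nat 3 = P.code) (a b : Fin 2) :
    (CExp.pauli a b).eval s = P.matrix a b := by
  cases P <;> fin_cases a <;> fin_cases b <;>
    simp [CExp.pauli, CExp.eval, NExp.eval_eq, NExp.eval, h, Pauli.code, Pauli.matrix]

def Obs.pauli : Obs → Pauli
  | .oneLocal P => P
  | .twoLocal P => P
  | .global P => P

theorem Obs.code_pauli (O : Obs) : O.pauli.code = O.pauliCode := by cases O <;> rfl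

/-- The number of qubits that carry the Dicke state, for the block with the label in register 4. -/
def NExp.tail : NExp := .sub (.reg 0) (.add (.reg 4) (.reg 4))

def CExp.collective : CExp :=
  .add (.add
    (.mul (.ofNat (.eq (.reg 7) (.reg 8)))
      (.add (.mul (.pauli 0 0) (.ofNat (.sub .tail (.reg 7)))) (.mul (.pauli 1 1) (.ofNat (.reg 7)))))
    (.mul (.ofNat (.eq (.reg 7) (.add (.reg 8) (.const 1))))
      (.mul (.pauli 1 0) (.sqrt (.mul (.ofNat (.reg 7)) (.ofNat (.sub .tail (.reg 8))))))))
    (.mul (.ofNat (.eq (.reg 8) (.add (.reg 7) (.const 1))))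
      (.mul (.pauli 0 1) (.sqrt (.mul (.ofNat (.reg 8)) (.ofNat (.sub .tail (.reg 7)))))))

/-- Entries of the blocks of the global observables; the array 5 holds tables of powers. -/
def CExp.global : CExp :=
  .mul (.mul (.mul (.read 5 [.const 2, .reg 4]) (.read 5 [.const 0, .sub .tail (.reg 7)]))
    (.read 5 [.const 1, .reg 7]))
    (.add
      (.mul (.ofNat (.eq (.reg 3) (.const 2))) (.ofNat (.eq (.reg 7) (.reg 8))))
      (.mul (.ofNat (.sub (.const 1) (.eq (.reg 3) (.const 2))))
        (.ofNat (.eq (.sub .tail (.reg 7)) (.reg 8)))))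

/-- Entries of the blocks of the observable with the label in the registers 2 and 3; the arrays 6
and 7 hold the block of the collective operator and its square. -/
def CExp.observable : CExp :=
  .add (.add
    (.mul (.ofNat (.eq (.reg 2) (.const 0)))
      (.mul (.div (.ofNat (.const 1)) (.ofNat (.reg 0))) (.read 6 [.reg 7, .reg 8])))
    (.mul (.ofNat (.eq (.reg 2) (.const 1)))
      (.mul (.div (.ofNat (.const 1))
          (.mul (.ofNat (.reg 0)) (.sub (.ofNat (.reg 0)) (.ofNat (.const 1)))))
        (.add (.read 7 [.reg 7, .reg 8])
          (.mul (.sub (.ofNat (.const 0)) (.ofNat (.reg 0))) (.ofNat (.eq (.reg 7) (.reg 8))))))))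
    (.mul (.ofNat (.eq (.reg 2) (.const 2))) .global)

/-- Entries of `Q e^{-iΛ}` for the generator with the label in register 6. -/
def CExp.phasedVectors : CExp :=
  .mul (.read 1 [.reg 6, .reg 4, .reg 7, .reg 8])
    (.exp (.mul (.sub (.ofNat (.const 0)) .imag) (.read 2 [.reg 6, .reg 4, .reg 8])))

def CExp.adjointVectors : CExp := .conj (.read 1 [.reg 6, .reg 4, .reg 8, .reg 7])

/-- The block of the circuit, in array 9. -/
def Cmd.layers (P : Cmd) : Cmd :=
  .for 6 (.reg 1) (.seq
    (.matMul P .phasedVectors .adjointVectors 10)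
    (.matMul P (.read 9 [.reg 7, .reg 8]) (.read 10 [.reg 7, .reg 8]) 9))

/-- Add the contribution of the block with the label in register 4 to the result. -/
def Cmd.block (P : Cmd) : Cmd :=
  .seq (.setNat 5 (.add .tail (.const 1))) <|
  .seq (.fill 6 .collective) <|
  .seq (.matMul P (.read 6 [.reg 7, .reg 8]) (.read 6 [.reg 7, .reg 8]) 7) <|
  .seq (.fill 8 .observable) <|
  .seq (.fill 9 (.ofNat (.eq (.reg 7) (.reg 8)))) <|
  .seq (.layers P) <|
  .seq (.matMul P (.read 8 [.reg 7, .reg 8]) (.read 9 [.reg 7, .reg 8]) 11) <|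
  .seq (.matMul P (.conj (.read 9 [.reg 8, .reg 7])) (.read 11 [.reg 7, .reg 8]) 12) <|
  .accum (.mul (.read 0 [.reg 4, .reg 7, .reg 8]) (.read 12 [.reg 8, .reg 7]))

/-- Fill a row of array 5 with the powers of a number. -/
def Cmd.powers (c : ℕ) (e : CExp) : Cmd :=
  .seq (.write 5 [.const c, .const 0] (.ofNat (.const 1)))
    (.for 9 (.reg 0) (.write 5 [.const c, .add (.reg 9) (.const 1)]
      (.mul (.read 5 [.const c, .reg 9]) e)))

/-- The simulation, with `P` multiplying matrices. -/
def Cmd.simulate (P : Cmd) : Cmd :=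
  .seq (.powers 0 (.add (.pauli 0 0) (.pauli 0 1))) <|
  .seq (.powers 1 (.add (.pauli 1 0) (.pauli 1 1))) <|
  .seq (.powers 2 (.sub (.ofNat (.const 0)) (.ofNat (.const 1)))) <|
  .seq (.write 3 [] (.ofNat (.const 0))) <|
  .for 4 (.add (.reg 0) (.const 1))
    (.ite (.add (.reg 4) (.reg 4)) (.add (.reg 0) (.const 1)) (.block P) .skip)

/-! ### Correctness and running time -/

theorem halts_powers {c : ℕ} {e : CExp} {s : State} {N : ℕ} {z : ℂ} (hN : s.nat 0 = N)
    (he : ∀ s', Agree (.powers c e) s s' → e.eval s' = z) :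
    Halts (.powers c e) s ((N + 2) * (e.cost + 30)) fun s' =>
      (∀ k ≤ N, s'.arr 5 [c, k] = z ^ k) ∧ ∀ c' k, c' ≠ c → s'.arr 5 [c', k] = s.arr 5 [c', k] := by
  have key : Halts (.powers c e) s _ _ :=
    Halts.seq (halts_write _ _ _ _) fun s₁ a₁ q₁ => halts_for (N := N) (T := e.cost + 9)
      (fun j f => (∀ k ≤ j, f 5 [c, k] = z ^ k) ∧ ∀ c' k, c' ≠ c → f 5 [c', k] = s.arr 5 [c', k])
      (by simp [Cmd.SetsReg]) (fun s' a' => ?_) ⟨?_, ?_⟩ (fun k _ s' a' hk hI => ?_)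
  · refine key.mono ?_ fun _ _ h => h
    simp only [NExp.cost, CExp.cost, List.map_cons, List.map_nil, List.sum_cons, List.sum_nil]
    nlinarith
  · change s'.nat 0 = N
    rw [a'.1 0 (by simp [Cmd.setsReg_for, Cmd.SetsReg]), a₁.1 0 (by simp [Cmd.SetsReg]), hN]
  · intro k hk
    obtain rfl : k = 0 := by omega
    simp [q₁, NExp.eval, CExp.eval]
  · intro c' k hc
    rw [q₁, Function.update_of_ne (by simp [NExp.eval, hc])]
  · have ha : Agree (.powers c e) s s' :=
      (a₁.mono (fun _ => Or.inl) fun _ => Or.inl).trans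
        (a'.mono (fun _ => Or.inr) fun _ => Or.inr)
    refine (halts_write _ _ _ _).mono ?_ fun s'' _ h => ⟨fun k' hk' => ?_, fun c' k' hc => ?_⟩
    · simp [NExp.cost, CExp.cost]
      omega
    · rw [h]
      simp only [List.map_cons, List.map_nil, NExp.eval, CExp.eval, he s' ha, hk, hI.1 k le_rfl]
      rcases Nat.lt_or_ge k k' with hlt | hle
      · obtain rfl : k' = k + 1 := by omega
        simp [pow_succ]
      · rw [Function.update_of_ne (by simp; omega), hI.1 k' hle]
    · rw [h, Function.update_of_ne (by simp [NExp.eval, hc]), hI.2 c' k' hc]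

variable {L : ℕ} {H : Fin L → Op n}

theorem HoldsInput.of_agree {s s' : State} {S : SchurBasis n} {ρ : Op n} {D : Diagonalization H}
    {O : Obs} {c : Cmd} (h : HoldsInput s S ρ D O) (ha : Agree c s s')
    (hr : ∀ x, c.SetsReg x → 4 ≤ x) (hc : ∀ a, c.SetsArr a → 3 ≤ a) : HoldsInput s' S ρ D O := by
  have hr' : ∀ x, x < 4 → s'.nat x = s.nat x := fun x hx => ha.1 x fun hc => by
    have := hr x hc; omega
  have hc' : ∀ x, x < 3 → s'.arr x = s.arr x := fun x hx => ha.2 x fun h => by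
    have := hc x h; omega
  constructor
  · rw [hr' 0 (by omega), h.size]
  · rw [hr' 1 (by omega), h.depth]
  · rw [hr' 2 (by omega), h.kind]
  · rw [hr' 3 (by omega), h.pauli]
  · rw [hc' 0 (by omega)]; exact h.state
  · rw [hc' 1 (by omega)]; exact h.vectors
  · rw [hc' 2 (by omega)]; exact h.values

/-- The array 5 holds the tables of powers. -/
structure HoldsPowers (n : ℕ) (f : List ℕ → ℂ) (P : Pauli) : Prop where
  zero : ∀ k ≤ n, f [0, k] = P.matrix 0 P.flip ^ k
  one : ∀ k ≤ n, f [1, k] = P.matrix 1 (1 + P.flip) ^ k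
  two : ∀ k ≤ n, f [2, k] = (-1) ^ k

/-- The memory while the block `m` is processed. -/
structure HoldsBlock (s : State) (S : SchurBasis n) (ρ : Op n) (D : Diagonalization H) (O : Obs)
    (m : Fin (n / 2 + 1)) : Prop where
  input : HoldsInput s S ρ D O
  powers : HoldsPowers n (s.arr 5) O.pauli
  label : s.nat 4 = m
  dim : s.nat 5 = blockDim n m

variable {S : SchurBasis n} {ρ : Op n} {D : Diagonalization H} {O : Obs} {m : Fin (n / 2 + 1)}
  {s s' : State}

theorem HoldsBlock.of_agree {c : Cmd} (h : HoldsBlock s S ρ D O m) (ha : Agree c s s')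
    (hr : ∀ x, c.SetsReg x → 6 ≤ x) (hc : ∀ a, c.SetsArr a → a = 3 ∨ 6 ≤ a) :
    HoldsBlock s' S ρ D O m where
  input := h.input.of_agree ha (fun x hx => by have := hr x hx; omega)
    fun a hx => by have := hc a hx; omega
  powers := by
    rw [ha.2 5 fun hx => by have := hc 5 hx; omega]; exact h.powers
  label := by rw [ha.1 4 fun hx => by have := hr 4 hx; omega, h.label]
  dim := by rw [ha.1 5 fun hx => by have := hr 5 hx; omega, h.dim]

theorem HoldsBlock.fill {a : ℕ} {e : CExp} (h : HoldsBlock s S ρ D O m)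
    (ha : Agree (.fill a e) s s') (h6 : 6 ≤ a) : HoldsBlock s' S ρ D O m :=
  h.of_agree ha (fun x hx => by rw [Cmd.setsReg_fill] at hx; omega)
    fun x hx => by rw [Cmd.setsArr_fill] at hx; omega

theorem HoldsBlock.accum {e : CExp} (h : HoldsBlock s S ρ D O m)
    (ha : Agree (.accum e) s s') : HoldsBlock s' S ρ D O m :=
  h.of_agree ha (fun x hx => by rw [Cmd.setsReg_accum] at hx; omega)
    fun x hx => by rw [Cmd.setsArr_accum] at hx; omega

theorem HoldsBlock.matMul {P : Cmd} {c : ℕ} {e e' : CExp} (h : HoldsBlock s S ρ D O m)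
    (ha : Agree (.matMul P e e' c) s s') (h6 : 6 ≤ c) : HoldsBlock s' S ρ D O m :=
  h.of_agree ha (fun x hx => by have := Cmd.setsReg_matMul hx; omega)
    fun x hx => by have := Cmd.setsArr_matMul hx; omega

theorem HoldsBlock.load {e e' : CExp} (h : HoldsBlock s S ρ D O m)
    (ha : Agree (.load e e') s s') : HoldsBlock s' S ρ D O m :=
  h.of_agree ha (fun x hx => by rw [Cmd.setsReg_load] at hx; omega)
    fun x hx => by rw [Cmd.setsArr_load] at hx; omega

theorem Agree.arr_load {b : ℕ} {e e' : CExp} (ha : Agree (.load e e') s s')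
    (hb : b < 32) : s'.arr b = s.arr b :=
  ha.2 b fun h => by rw [Cmd.setsArr_load] at h; omega

theorem Agree.arr_fill {a b : ℕ} {e : CExp} (ha : Agree (.fill a e) s s') (hb : b ≠ a) :
    s'.arr b = s.arr b := ha.2 b (by rwa [Cmd.setsArr_fill])

theorem Agree.arr_matMul {P : Cmd} {b c : ℕ} {e e' : CExp} (ha : Agree (.matMul P e e' c) s s')
    (hb : b ≠ c) (hb' : b < 32) : s'.arr b = s.arr b :=
  ha.2 b fun h => by have := Cmd.setsArr_matMul h; omega

theorem Cmd.setsReg_layers {P : Cmd} {x : ℕ} (h : (Cmd.layers P).SetsReg x) : 6 ≤ x := by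
  rw [Cmd.layers, Cmd.setsReg_for] at h
  rcases h with h | h | h
  · omega
  · have := Cmd.setsReg_matMul h; omega
  · have := Cmd.setsReg_matMul h; omega

theorem Cmd.setsArr_layers {P : Cmd} {x : ℕ} (h : (Cmd.layers P).SetsArr x) :
    x = 9 ∨ x = 10 ∨ 32 ≤ x := by
  rw [Cmd.layers, Cmd.setsArr_for] at h
  rcases h with h | h
  · have := Cmd.setsArr_matMul h; omega
  · have := Cmd.setsArr_matMul h; omega

theorem HoldsBlock.eval_tail (h : HoldsBlock s S ρ D O m) : NExp.tail.eval s = n - 2 * m := by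
  simp only [NExp.tail, NExp.eval, h.label, h.input.size]
  omega

theorem HoldsBlock.eval_collective (h : HoldsBlock s S ρ D O m) {i j : Fin (blockDim n m)}
    (hi : s.nat 7 = i) (hj : s.nat 8 = j) :
    CExp.collective.eval s = O.pauli.collectiveBlock n m i j := by
  have hp : s.nat 3 = O.pauli.code := by rw [h.input.pauli, O.code_pauli]
  have hre : ∀ a b : ℕ, ((a : ℂ) * (b : ℂ)).re = ((a * b : ℕ) : ℝ) := by
    intro a b; rw [← Nat.cast_mul, Complex.natCast_re]
  simp only [CExp.collective, CExp.eval, CExp.eval_pauli hp, NExp.eval_eq, NExp.eval, h.eval_tail,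
    hi, hj, hre, Pauli.collectiveBlock, Matrix.of_apply, collectiveEntry, Nat.cast_ite,
    Nat.cast_one, Nat.cast_zero, ite_mul, one_mul, zero_mul]

theorem HoldsBlock.eval_global (h : HoldsBlock s S ρ D O m) {i j : Fin (blockDim n m)}
    (hi : s.nat 7 = i) (hj : s.nat 8 = j) :
    CExp.global.eval s = O.pauli.globalEntry m (n - 2 * m) i j := by
  have hp : s.nat 3 = O.pauli.code := by rw [h.input.pauli, O.code_pauli]
  have hiN : (i : ℕ) ≤ n := by have := i.2; simp only [blockDim] at this; omega
  simp only [CExp.global, CExp.eval, NExp.eval_eq, NExp.eval, h.eval_tail, h.label,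
    List.map_cons, List.map_nil, hi, hj, hp, h.powers.zero (n - 2 * m - i) (by omega),
    h.powers.one i hiN, h.powers.two m (by omega), Pauli.globalEntry]
  congr 1
  cases O.pauli <;> simp [Pauli.code, Pauli.reflect, Pauli.flip]

theorem HoldsBlock.eval_observable (h : HoldsBlock s S ρ D O m) {i j : Fin (blockDim n m)}
    (hi : s.nat 7 = i) (hj : s.nat 8 = j) (h6 : IsMat (s.arr 6) (O.pauli.collectiveBlock n m))
    (h7 : IsMat (s.arr 7) (O.pauli.collectiveBlock n m * O.pauli.collectiveBlock n m)) :
    CExp.observable.eval s = O.blocks n m i j := by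
  simp only [CExp.observable, CExp.eval, NExp.eval_eq, NExp.eval, h.eval_global hi hj,
    List.map_cons, List.map_nil, hi, hj, h6 i j, h7 i j, h.input.kind, h.input.size]
  by_cases hij : (i : ℕ) = j <;> cases O <;>
    simp [Obs.kindCode, Obs.blocks, Obs.pauli, Matrix.one_apply, Fin.ext_iff, hij]

theorem CExp.eval_eq_idx {d : ℕ} {i j : Fin d} (hi : s.nat 7 = i) (hj : s.nat 8 = j) :
    (CExp.ofNat (.eq (.reg 7) (.reg 8))).eval s = (1 : Matrix (Fin d) (Fin d) ℂ) i j := by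
  simp [CExp.eval, NExp.eval_eq, NExp.eval, hi, hj, Matrix.one_apply, Fin.ext_iff]

theorem IsMat.eval_read {a d : ℕ} {M : Matrix (Fin d) (Fin d) ℂ} {i j : Fin d}
    (h : IsMat (s.arr a) M) (hi : s.nat 7 = i) (hj : s.nat 8 = j) :
    (CExp.read a [.reg 7, .reg 8]).eval s = M i j := by
  simp only [CExp.eval, List.map_cons, List.map_nil, NExp.eval, hi, hj]
  exact h i j

theorem MultipliesIn.mono {P : Cmd} {d T U : ℕ} (h : MultipliesIn P d T) (hT : T ≤ U) :
    MultipliesIn P d U := fun A B s h0 hA hB => by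
  obtain ⟨t, s', hr, hres, ht⟩ := h A B s h0 hA hB
  exact ⟨t, s', hr, hres, ht.trans hT⟩

theorem halts_layers {P : Cmd} {Y : ℕ} (hP : MultipliesIn P (blockDim n m) Y)
    (hY : (blockDim n m + 1) * (blockDim n m + 1) ≤ Y) (h : HoldsBlock s S ρ D O m)
    (h9 : IsMat (s.arr 9) (1 : Matrix (Fin (blockDim n m)) (Fin (blockDim n m)) ℂ)) :
    Halts (.layers P) s ((L + 1) * (200 * Y)) fun s' =>
      IsMat (s'.arr 9) (List.ofFn fun l => D.layer l m).prod := by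
  have hY1 : 1 ≤ Y := le_trans (by nlinarith) hY
  set E := List.ofFn fun l => D.layer l m with hE
  have hlen : E.length = L := by simp [hE]
  have key : Halts (.layers P) s _ fun s' => IsMat (s'.arr 9) (E.take L).prod :=
    halts_for (N := L) (T := 190 * Y) (fun k f => IsMat (f 9) (E.take k).prod)
      ?_ (fun s' ha => ?_) (by simpa using h9) (fun k hk s' ha h6 hI => ?_)
  · rw [List.take_of_length_le hlen.le] at key
    refine key.mono (Nat.mul_le_mul_left _ ?_) fun _ _ h => h
    simp only [NExp.cost]
    omega
  · rintro (h | h)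
    · have := Cmd.setsReg_matMul h; omega
    · have := Cmd.setsReg_matMul h; omega
  · exact (h.of_agree ha (fun x => Cmd.setsReg_layers) fun a hx => by
      have := Cmd.setsArr_layers hx; omega).input.depth
  · have h' := h.of_agree ha (fun x => Cmd.setsReg_layers) fun a hx => by
      have := Cmd.setsArr_layers hx; omega
    have key : Halts (.seq (.matMul P .phasedVectors .adjointVectors 10)
        (.matMul P (.read 9 [.reg 7, .reg 8]) (.read 10 [.reg 7, .reg 8]) 9)) s' _
        fun s'' => IsMat (s''.arr 9) ((E.take k).prod * D.layer ⟨k, hk⟩ m) :=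
      Halts.seq (halts_matMul (by omega) hP (D.Q ⟨k, hk⟩ m * Matrix.diagonal
          (fun q => Complex.exp (-Complex.I * D.eig ⟨k, hk⟩ m q)))
        (D.Q ⟨k, hk⟩ m).conjTranspose h'.dim (fun i j s₁ a₁ hi hj => ?_)
        (fun i j s₁ a₁ hi hj => ?_)) fun s₁ a₁ q₁ =>
      halts_matMul (by omega) hP _ _ (h'.matMul a₁ (by omega)).dim (fun i j s₂ a₂ hi hj => ?_)
        (fun i j s₂ a₂ hi hj => ?_)
    · refine key.mono ?_ fun s'' _ hs'' => ?_
      · simp only [CExp.phasedVectors, CExp.adjointVectors, CExp.cost, NExp.cost, List.map_cons,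
          List.map_nil, List.sum_cons, List.sum_nil]
        nlinarith
      · rw [List.prod_take_succ E k (by omega)]
        simpa [hE] using hs''
    · have h₁ := h'.load a₁
      have h6' : s₁.nat 6 = k := by rw [a₁.1 6 (by simp [Cmd.setsReg_load]), h6]
      simp only [CExp.phasedVectors, CExp.eval, NExp.eval, List.map_cons, List.map_nil, hi, hj,
        h₁.label, h6', Matrix.mul_diagonal, Nat.cast_zero, zero_sub,
        h₁.input.vectors ⟨k, hk⟩ m i j, h₁.input.values ⟨k, hk⟩ m j]
    · have h₁ := h'.load a₁
      have h6' : s₁.nat 6 = k := by rw [a₁.1 6 (by simp [Cmd.setsReg_load]), h6]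
      simp only [CExp.adjointVectors, CExp.eval, NExp.eval, List.map_cons, List.map_nil, hi, hj,
        h₁.label, h6', h₁.input.vectors ⟨k, hk⟩ m j i, Matrix.conjTranspose_apply]
      rfl
    · refine IsMat.eval_read ?_ hi hj
      rw [a₂.arr_load (by omega), a₁.arr_matMul (by omega) (by omega)]
      exact hI
    · refine IsMat.eval_read ?_ hi hj
      rw [a₂.arr_load (by omega)]
      exact q₁

theorem halts_block {P : Cmd} {Y : ℕ} (hP : MultipliesIn P (blockDim n m) Y)
    (hY : (blockDim n m + 1) * (blockDim n m + 1) ≤ Y) (hin : HoldsInput s S ρ D O)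
    (hpow : HoldsPowers n (s.arr 5) O.pauli) (hm : s.nat 4 = m) :
    Halts (.block P) s ((L + 1) * (3000 * Y)) fun s' => s'.arr 3 [] = s.arr 3 [] +
      ∑ i, ∑ j, stateComponent S ρ m i j *
        (((List.ofFn fun l => D.layer l m).prod).conjTranspose *
          (O.blocks n m * (List.ofFn fun l => D.layer l m).prod)) j i := by
  set J := O.pauli.collectiveBlock n m with hJ
  set V := (List.ofFn fun l => D.layer l m).prod with hV
  have hY1 : 1 ≤ Y := le_trans (by nlinarith) hY
  have fillY : ∀ e : CExp, e.cost ≤ 383 →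
      (blockDim n m + 1) * ((blockDim n m + 1) * (e.cost + 17)) ≤ 400 * Y := fun e he => by
    nlinarith [Nat.mul_le_mul hY (show e.cost + 17 ≤ 400 by omega)]
  have mulY : ∀ e e' : CExp, e.cost + e'.cost ≤ 100 → Y + (blockDim n m + 1) *
      ((blockDim n m + 1) * (e.cost + e'.cost + 60)) ≤ 200 * Y := fun e e' he => by
    nlinarith [Nat.mul_le_mul hY (show e.cost + e'.cost + 60 ≤ 160 by omega)]
  have key : Halts (.block P) s (20 * Y + (400 * Y + (200 * Y + (400 * Y + (400 * Y +
      ((L + 1) * (200 * Y) + (200 * Y + (200 * Y + 400 * Y)))))))) fun s' =>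
      s'.arr 3 [] = s.arr 3 [] + ∑ i, ∑ j, stateComponent S ρ m i j *
        (V.conjTranspose * (O.blocks n m * V)) j i := by
    refine Halts.seq ((halts_setNat _ _ _).mono (U := 20 * Y)
      (by simp [NExp.cost, NExp.tail]; omega) fun _ _ h => h) fun s₀ a₀ q₀ => ?_
    have h₀ : HoldsBlock s₀ S ρ D O m := by
      refine ⟨hin.of_agree a₀ (fun x hx => ?_) fun a hx => hx.elim, by rwa [q₀.2], ?_, ?_⟩
      · simp only [Cmd.SetsReg] at hx; omega
      · rw [a₀.1 4 (by simp [Cmd.SetsReg]), hm]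
      · rw [q₀.1]
        simp only [NExp.tail, NExp.eval, hm, hin.size, blockDim]
        omega
    refine Halts.seq ((halts_fill J h₀.dim fun i j s' a hi hj =>
      (h₀.fill a (by omega)).eval_collective hi hj).mono (fillY _ (by decide)) fun _ _ h => h)
      fun s₁ a₁ q₁ => ?_
    have h₁ := h₀.fill a₁ (by omega)
    refine Halts.seq ((halts_matMul (by omega) hP J J h₁.dim
      (fun i j s' a hi hj => IsMat.eval_read (by rwa [a.arr_load (by omega)]) hi hj)
      (fun i j s' a hi hj => IsMat.eval_read (by rwa [a.arr_load (by omega)]) hi hj)).mono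
        (mulY _ _ (by decide)) fun _ _ h => h) fun s₂ a₂ q₂ => ?_
    have h₂ := h₁.matMul a₂ (by omega)
    have hJ₂ : IsMat (s₂.arr 6) J := by rwa [a₂.arr_matMul (by omega) (by omega)]
    refine Halts.seq ((halts_fill (O.blocks n m) h₂.dim fun i j s' a hi hj =>
      (h₂.fill a (by omega)).eval_observable hi hj (by rwa [a.arr_fill (by omega)])
        (by rwa [a.arr_fill (by omega)])).mono (fillY _ (by decide)) fun _ _ h => h)
      fun s₃ a₃ q₃ => ?_
    have h₃ := h₂.fill a₃ (by omega)
    refine Halts.seq ((halts_fill 1 h₃.dim fun i j s' a hi hj =>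
      CExp.eval_eq_idx hi hj).mono (fillY _ (by decide)) fun _ _ h => h) fun s₄ a₄ q₄ => ?_
    have h₄ := h₃.fill a₄ (by omega)
    refine Halts.seq (halts_layers hP hY h₄ q₄) fun s₅ a₅ q₅ => ?_
    have h₅ := h₄.of_agree a₅ (fun x => Cmd.setsReg_layers) fun a hx => by
      have := Cmd.setsArr_layers hx; omega
    have hO₅ : IsMat (s₅.arr 8) (O.blocks n m) := by
      rwa [a₅.2 8 fun hx => by have := Cmd.setsArr_layers hx; omega, a₄.arr_fill (by omega)]
    refine Halts.seq ((halts_matMul (by omega) hP (O.blocks n m) V h₅.dim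
      (fun i j s' a hi hj => IsMat.eval_read (by rwa [a.arr_load (by omega)]) hi hj)
      (fun i j s' a hi hj => IsMat.eval_read (by rwa [a.arr_load (by omega)]) hi hj)).mono
        (mulY _ _ (by decide)) fun _ _ h => h) fun s₆ a₆ q₆ => ?_
    have h₆ := h₅.matMul a₆ (by omega)
    have hV₆ : IsMat (s₆.arr 9) V := by rwa [a₆.arr_matMul (by omega) (by omega)]
    refine Halts.seq ((halts_matMul (by omega) hP V.conjTranspose (O.blocks n m * V) h₆.dim
      (fun i j s' a hi hj => ?_)
      (fun i j s' a hi hj => IsMat.eval_read (by rwa [a.arr_load (by omega)]) hi hj)).mono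
        (mulY _ _ (by decide)) fun _ _ h => h) fun s₇ a₇ q₇ => ?_
    · simp only [CExp.eval, List.map_cons, List.map_nil, NExp.eval, hi, hj,
        a.arr_load (show 9 < 32 by omega), hV₆ j i, Matrix.conjTranspose_apply]
      rfl
    have h₇ := h₆.matMul a₇ (by omega)
    refine (halts_accum (Matrix.of fun i j => stateComponent S ρ m i j *
      (V.conjTranspose * (O.blocks n m * V)) j i) h₇.dim fun i j s' a hi hj => ?_).mono
      (fillY _ (by decide)) fun s' _ h => ?_
    · have h' := h₇.accum a
      simp only [CExp.eval, List.map_cons, List.map_nil, NExp.eval, hi, hj, h'.label,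
        h'.input.state m i j, a.2 12 (by rw [Cmd.setsArr_accum]; omega), q₇ j i, Matrix.of_apply]
    · rw [h, a₇.arr_matMul (by omega) (by omega), a₆.arr_matMul (by omega) (by omega),
        a₅.2 3 fun hx => by have := Cmd.setsArr_layers hx; omega, a₄.arr_fill (by omega),
        a₃.arr_fill (by omega), a₂.arr_matMul (by omega) (by omega), a₁.arr_fill (by omega), q₀.2]
      rfl
  refine key.mono ?_ fun _ _ h => h
  nlinarith [Nat.zero_le (L * Y)]

theorem Cmd.setsReg_block {P : Cmd} {x : ℕ} (h : (Cmd.block P).SetsReg x) : 5 ≤ x := by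
  rcases h with h | h | h | h | h | h | h | h | h
  · simp only [Cmd.SetsReg] at h; omega
  · rw [Cmd.setsReg_fill] at h; omega
  · have := Cmd.setsReg_matMul h; omega
  · rw [Cmd.setsReg_fill] at h; omega
  · rw [Cmd.setsReg_fill] at h; omega
  · have := Cmd.setsReg_layers h; omega
  · have := Cmd.setsReg_matMul h; omega
  · have := Cmd.setsReg_matMul h; omega
  · rw [Cmd.setsReg_accum] at h; omega

theorem Cmd.setsArr_block {P : Cmd} {x : ℕ} (h : (Cmd.block P).SetsArr x) : x = 3 ∨ 6 ≤ x := by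
  rcases h with h | h | h | h | h | h | h | h | h
  · exact h.elim
  · rw [Cmd.setsArr_fill] at h; omega
  · have := Cmd.setsArr_matMul h; omega
  · rw [Cmd.setsArr_fill] at h; omega
  · rw [Cmd.setsArr_fill] at h; omega
  · have := Cmd.setsArr_layers h; omega
  · have := Cmd.setsArr_matMul h; omega
  · have := Cmd.setsArr_matMul h; omega
  · rw [Cmd.setsArr_accum] at h; omega

theorem Cmd.setsReg_powers {c x : ℕ} {e : CExp} : (Cmd.powers c e).SetsReg x ↔ x = 9 := by
  simp [Cmd.powers, Cmd.setsReg_for, Cmd.SetsReg]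

theorem Cmd.setsArr_powers {c x : ℕ} {e : CExp} : (Cmd.powers c e).SetsArr x ↔ x = 5 := by
  simp [Cmd.powers, Cmd.setsArr_for, Cmd.SetsArr]

theorem HoldsInput.powers {c : ℕ} {e : CExp} (h : HoldsInput s S ρ D O)
    (ha : Agree (.powers c e) s s') : HoldsInput s' S ρ D O :=
  h.of_agree ha (fun x hx => by rw [Cmd.setsReg_powers] at hx; omega)
    fun x hx => by rw [Cmd.setsArr_powers] at hx; omega

theorem Pauli.sum_row (P : Pauli) (a : Fin 2) :
    P.matrix a 0 + P.matrix a 1 = P.matrix a (a + P.flip) := by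
  cases P <;> fin_cases a <;> simp [Pauli.matrix, Pauli.flip]

theorem halts_simulate {P : Cmd} {Y : ℕ}
    (hP : ∀ m : Fin (n / 2 + 1), MultipliesIn P (blockDim n m) Y)
    (hY : (n + 2) * (n + 2) ≤ Y) (hH : ∀ l, IsEquivariant (H l)) (h : HoldsInput s S ρ D O) :
    Halts (.simulate P) s ((n + 2) * ((L + 1) * (4000 * Y))) fun s' =>
      s'.arr 3 [] = expectation (circuit H) ρ (O.op n) := by
  have hY1 : 1 ≤ Y := le_trans (by nlinarith) hY
  set g : Fin (n / 2 + 1) → ℂ := fun m => ∑ i, ∑ j, stateComponent S ρ m i j *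
        (((List.ofFn fun l => D.layer l m).prod).conjTranspose *
          (O.blocks n m * (List.ofFn fun l => D.layer l m).prod)) j i with hg
  have hexp : expectation (circuit H) ρ (O.op n) = ∑ m, g m :=
    expectation_circuit hH S D ρ (O.op n) (O.hasBlocks S)
  set g' : ℕ → ℂ := fun k => if hk : k < n / 2 + 1 then g ⟨k, hk⟩ else 0 with hg'
  have hsum : ∑ m, g m = ∑ k ∈ Finset.range (n + 1), g' k := by
    rw [← Finset.sum_subset (Finset.range_mono (show n / 2 + 1 ≤ n + 1 by omega))
      (fun k _ hk => dif_neg (by simpa using hk)), ← Fin.sum_univ_eq_sum_range g']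
    exact Finset.sum_congr rfl fun m _ => by simp only [hg', dif_pos m.2]
  rw [hexp, hsum]
  have hpauli : ∀ {s' : State}, HoldsInput s' S ρ D O → s'.nat 3 = O.pauli.code :=
    fun h => by rw [h.pauli, O.code_pauli]
  have key : Halts (.simulate P) s ((n + 2) * 100 + ((n + 2) * 100 + ((n + 2) * 100 + (3 +
      (n + 1 + 1) * ((8 + (L + 1) * (3000 * Y)) + 3 + 6))))) fun s' =>
      s'.arr 3 [] = ∑ k ∈ Finset.range (n + 1), g' k := by
    refine Halts.seq ((halts_powers (z := O.pauli.matrix 0 O.pauli.flip) h.size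
      fun s' a => ?_).mono (by gcongr; decide) fun _ _ h => h) fun s₁ a₁ q₁ => ?_
    · rw [CExp.eval, CExp.eval_pauli (hpauli (h.powers a)), CExp.eval_pauli (hpauli (h.powers a)),
        O.pauli.sum_row, zero_add]
    have h₁ := h.powers a₁
    refine Halts.seq ((halts_powers (z := O.pauli.matrix 1 (1 + O.pauli.flip)) h₁.size
      fun s' a => ?_).mono (by gcongr; decide) fun _ _ h => h) fun s₂ a₂ q₂ => ?_
    · rw [CExp.eval, CExp.eval_pauli (hpauli (h₁.powers a)),
        CExp.eval_pauli (hpauli (h₁.powers a)), O.pauli.sum_row]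
    have h₂ := h₁.powers a₂
    refine Halts.seq ((halts_powers (z := -1) h₂.size
      fun s' a => by simp [CExp.eval, NExp.eval]).mono (by gcongr; decide) fun _ _ h => h)
      fun s₃ a₃ q₃ => ?_
    have h₃ := h₂.powers a₃
    refine Halts.seq ((halts_write _ _ _ _).mono (by decide) fun _ _ h => h) fun s₄ a₄ q₄ => ?_
    have h₄ : HoldsInput s₄ S ρ D O := h₃.of_agree a₄ (fun _ hx => hx.elim)
      fun a hx => by simp only [Cmd.SetsArr] at hx; omega
    have p₄ : HoldsPowers n (s₄.arr 5) O.pauli := by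
      rw [a₄.2 5 (by simp [Cmd.SetsArr])]
      refine ⟨fun k hk => ?_, fun k hk => ?_, fun k hk => q₃.1 k hk⟩
      · rw [q₃.2 0 k (by omega), q₂.2 0 k (by omega), q₁.1 k hk]
      · rw [q₃.2 1 k (by omega), q₂.1 k hk]
    have hreg : ∀ x, (Cmd.for 4 (.add (.reg 0) (.const 1)) (.ite (.add (.reg 4) (.reg 4))
        (.add (.reg 0) (.const 1)) (.block P) .skip)).SetsReg x → 4 ≤ x := by
      intro x hx
      rcases Cmd.setsReg_for.1 hx with hx | hx | hx
      · omega
      · have := Cmd.setsReg_block hx; omega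
      · exact hx.elim
    have harr : ∀ x, (Cmd.for 4 (.add (.reg 0) (.const 1)) (.ite (.add (.reg 4) (.reg 4))
        (.add (.reg 0) (.const 1)) (.block P) .skip)).SetsArr x → x = 3 ∨ 6 ≤ x := by
      intro x hx
      rcases Cmd.setsArr_for.1 hx with hx | hx
      · exact Cmd.setsArr_block hx
      · exact hx.elim
    refine halts_for (N := n + 1) (T := 8 + (L + 1) * (3000 * Y))
      (fun k f => f 3 [] = ∑ i ∈ Finset.range k, g' i) ?_ (fun s' a => ?_) ?_
      (fun k hk s' a hr hI => ?_)
    · rintro (hx | hx)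
      · have := Cmd.setsReg_block hx; omega
      · exact hx
    · simp only [NExp.eval]
      rw [a.1 0 fun hx => by have := hreg 0 hx; omega, h₄.size]
    · simp [q₄, CExp.eval, NExp.eval]
    · have h' : HoldsInput s' S ρ D O := h₄.of_agree a hreg
        fun x hx => by have := harr x hx; omega
      have p' : HoldsPowers n (s'.arr 5) O.pauli := by
        rwa [a.2 5 fun hx => by have := harr 5 hx; omega]
      refine (halts_ite (T := (L + 1) * (3000 * Y)) (fun hlt => ?_) (fun hge => ?_)).mono
        (by simp [NExp.cost]) fun _ _ h => h
      · simp only [NExp.eval, hr, h'.size] at hlt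
        have hk' : k < n / 2 + 1 := by omega
        refine (halts_block (m := ⟨k, hk'⟩) (hP _) (le_trans ?_ hY) h' p' hr).mono le_rfl
          fun s'' _ hs'' => ?_
        · have : blockDim n k ≤ n + 1 := by simp only [blockDim]; omega
          exact Nat.mul_le_mul (by simpa using this) (by simpa using this)
        · rw [hs'', hI, Finset.sum_range_succ, hg']
          simp only [dif_pos hk']
          rfl
      · simp only [NExp.eval, hr, h'.size] at hge
        refine (halts_skip ?_).mono (by nlinarith [Nat.zero_le (L * Y)]) fun _ _ h => h
        rw [hI, Finset.sum_range_succ, hg']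
        simp only [dif_neg (show ¬ k < n / 2 + 1 by omega), add_zero]
  refine key.mono ?_ fun _ _ h => h
  have hLY : 1 ≤ (L + 1) * Y := Nat.one_le_iff_ne_zero.2 (by positivity)
  nlinarith [Nat.mul_le_mul_left (n + 2) hLY]

end SnSim

theorem corollary1 (ω : ℝ) (hω : SnSim.IsMatMulExponent ω) :
    ∃ P : SnSim.Cmd, ∀ L₀ : ℕ, ∃ C : ℝ, ∀ n L : ℕ, 2 ≤ n → L ≤ L₀ →
      ∀ (H : Fin L → SnSim.Op n) (ρ : SnSim.Op n) (O : SnSim.Obs),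
        (∀ l, (H l).IsHermitian ∧ SnSim.IsEquivariant (H l)) →
        SnSim.IsDensity ρ →
        ∀ (S : SnSim.SchurBasis n) (D : SnSim.Diagonalization H) (s : SnSim.State),
          SnSim.HoldsInput s S ρ D O →
          ∃ (t : ℕ) (s' : SnSim.State), SnSim.Run P s t s' ∧
            s'.arr 3 [] = SnSim.expectation (SnSim.circuit H) ρ (O.op n) ∧
            (t : ℝ) ≤ C * (n : ℝ) ^ (ω + 1) := by
  have h2 : 2 ≤ ω := hω.two_le
  obtain ⟨P, C, hP⟩ := hω
  refine ⟨.simulate P, fun L₀ => ⟨2 * ((L₀ + 1) * (4000 * (5 + |C| * 2 ^ ω))),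
    fun n L hn hL H ρ O hH _ S D s hs => ?_⟩⟩
  have hn1 : (2 : ℝ) ≤ n := by exact_mod_cast hn
  have hn0 : (0 : ℝ) < n := by linarith
  set T : ℕ := ⌈|C| * (2 * (n : ℝ)) ^ ω⌉₊ with hT
  have hmul : ∀ m : Fin (n / 2 + 1), SnSim.MultipliesIn P (SnSim.blockDim n m) T := by
    intro m A B s h0 hA hB
    obtain ⟨t, s', hr, hres, ht⟩ := hP _ (by simp [SnSim.blockDim]) A B s h0 hA hB
    refine ⟨t, s', hr, hres, ?_⟩
    have hd : ((SnSim.blockDim n m : ℕ) : ℝ) ≤ 2 * n := by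
      have : SnSim.blockDim n m ≤ 2 * n := by simp only [SnSim.blockDim]; omega
      exact_mod_cast this
    have : (t : ℝ) ≤ T := by
      refine ht.trans (le_trans ?_ (Nat.le_ceil _))
      exact mul_le_mul (le_abs_self C) (Real.rpow_le_rpow (by positivity) hd (by linarith))
        (by positivity) (abs_nonneg _)
    exact_mod_cast this
  obtain ⟨t, s', hr, ht, _, hres⟩ := SnSim.halts_simulate (Y := (n + 2) * (n + 2) + T)
    (fun m => (hmul m).mono (Nat.le_add_left _ _)) (Nat.le_add_right _ _) (fun l => (hH l).2) hs
  refine ⟨t, s', hr, hres, ?_⟩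
  have hsq : (n : ℝ) ^ 2 ≤ (n : ℝ) ^ ω := by
    rw [← Real.rpow_two]
    exact Real.rpow_le_rpow_of_exponent_le (by linarith) h2
  have hTle : (T : ℝ) ≤ |C| * 2 ^ ω * (n : ℝ) ^ ω + 1 := by
    refine (Nat.ceil_lt_add_one (by positivity)).le.trans_eq ?_
    rw [Real.mul_rpow (by norm_num) hn0.le, mul_assoc]
  have hY : (((n + 2) * (n + 2) + T : ℕ) : ℝ) ≤ (5 + |C| * 2 ^ ω) * (n : ℝ) ^ ω := by
    push_cast
    nlinarith
  calc (t : ℝ) ≤ (((n + 2) * ((L + 1) * (4000 * ((n + 2) * (n + 2) + T))) : ℕ) : ℝ) := by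
        exact_mod_cast ht
    _ = ((n : ℝ) + 2) * (((L : ℝ) + 1) * (4000 * (((n + 2) * (n + 2) + T : ℕ) : ℝ))) := by
        push_cast; ring
    _ ≤ (2 * (n : ℝ)) * (((L₀ : ℝ) + 1) * (4000 * ((5 + |C| * 2 ^ ω) * (n : ℝ) ^ ω))) := by
        have hLL : (L : ℝ) ≤ L₀ := by exact_mod_cast hL
        gcongr
        linarith
    _ = 2 * ((L₀ + 1) * (4000 * (5 + |C| * 2 ^ ω))) * (n : ℝ) ^ (ω + 1) := by
        rw [Real.rpow_add_one hn0.ne']; ring
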